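/- Let $G$ be a finite connected simple graph on $n$ vertices containing exactly one cycle $C$, and let $c\ge 3$ be the number of vertices of $C$. Let $k$ be the number of internal edges of $G$ (edges both of whose endpoints have degree at least $2$), and let $r$ be the number of non-trivial rooted trees attached to $C$, i.e. the number of vertices $v$ of $C$ whose connected component in $G\setminus E(C)$ has more than one vertex. Let $\mathbf{X}_G=\sum_{\kappa}\prod_{v\in V(G)}x_{\kappa(v)}$ be the chromatic symmetric function of $G$ (the sum is over all proper colorings $\kappa:V(G)\to\mathbb{N}$). Let $\mathfrak{st}_j$ be the chromatic symmetric function of the star graph on $j$ vertices, and put $\mathfrak{st}_\lambda=\mathfrak{st}_{\lambda_1}\cdots\mathfrak{st}_{\lambda_\ell}$ for a partition $\lambda=(\lambda_1,\dots,\lambda_\ell)$. Then there are unique rational numbers $a_\lambda$ with $\mathbf{X}_G=\sum_{\lambda\vdash n}a_\lambda\,\mathfrak{st}_\lambda$. Among the hook partitions of $n$, that is, the partitions $(n-m,1^{m})$ with $0\le m<n$, at least one has a nonzero coefficient. Let $\tilde\lambda$ be the longest hook partition (the one with the most parts) such that $a_{\tilde\lambda}\ne 0$, and let $m_1$ be the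 number of parts of $\tilde\lambda$ equal to $1$. Then $$k=\begin{cases} m_1+2 & \text{if } r=0 \text{ or } r=1,\\ m_1+1 & \text{if } r\ge 2,\end{cases}$$ and $$a_{\tilde\lambda}=\begin{cases} (-1)^{k-2} & \text{if } r=0,\\ (-1)^{k-2}(c-1) & \text{if } r=1,\\ (-1)^{k-1}(r-1) & \text{if } r\ge 2.\end{cases}$$ -/

import Mathlib

namespace SimpleGraph

/-- The monomial exponent of `∏ v, x_{κ v}` is `∑ v, single (κ v) 1`. The chromatic symmetric
function `∑_κ ∏_v x_{κ v}` (sum over all proper colorings `κ : V → ℕ`) is the formal power series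
whose coefficient at a monomial `x ^ d` is the number of proper colorings `κ` giving `x ^ d`. -/
noncomputable def chromaticSymm {V : Type*} [Fintype V] (G : SimpleGraph V) :
    MvPowerSeries ℕ ℚ :=
  fun d : ℕ →₀ ℕ =>
    (Nat.card {κ : G.Coloring ℕ // ∑ v : V, Finsupp.single (κ v) 1 = d} : ℚ)

/-- Only finitely many proper colorings give a fixed monomial, so `Nat.card` above is a genuine
count. -/
theorem finite_colorings_of_monomial {V : Type*} [Fintype V] (G : SimpleGraph V) (d : ℕ →₀ ℕ) :
    Finite {κ : G.Coloring ℕ // ∑ v : V, Finsupp.single (κ v) 1 = d} := by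
  have key : ∀ (κ : {κ : G.Coloring ℕ // ∑ v : V, Finsupp.single (κ v) 1 = d}) (v : V),
      κ.1 v ∈ d.support := by
    rintro ⟨κ, hκ⟩ v
    subst hκ
    rw [Finsupp.mem_support_iff, Finsupp.finsetSum_apply]
    have h : 1 ≤ ∑ w : V, (Finsupp.single (κ w) 1 : ℕ →₀ ℕ) (κ v) := by
      refine le_trans ?_ (Finset.single_le_sum
        (f := fun w => (Finsupp.single (κ w) 1 : ℕ →₀ ℕ) (κ v))
        (fun _ _ => Nat.zero_le _) (Finset.mem_univ v))
      simp
    exact Nat.one_le_iff_ne_zero.mp h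
  refine Finite.of_injective
    (β := V → d.support) (fun κ v => ⟨κ.1 v, key κ v⟩) ?_
  intro κ κ' h
  apply Subtype.ext
  apply RelHom.ext
  intro v
  exact congrArg Subtype.val (congrFun h v)

/-- `st k` is the chromatic symmetric function of the star graph on `k ≥ 1` vertices
(with the empty product `1` as the value for `k = 0`, which is never a part of a partition). -/
noncomputable def starSymm : ℕ → MvPowerSeries ℕ ℚ
  | 0 => 1
  | k + 1 => (starGraph (0 : Fin (k + 1))).chromaticSymm

/-- `st_λ = st_{λ₁} st_{λ₂} ⋯ st_{λ_ℓ}`. -/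
noncomputable def starSymmPart {n : ℕ} (lam : n.Partition) : MvPowerSeries ℕ ℚ :=
  (lam.parts.map starSymm).prod

/-- `X_G = ∑_{λ ⊢ n} a_λ st_λ`. -/
def IsStarExpansion {V : Type*} [Fintype V] (G : SimpleGraph V) {n : ℕ}
    (a : n.Partition → ℚ) : Prop :=
  G.chromaticSymm = ∑ lam : n.Partition, a lam • starSymmPart lam

/-- A hook partition of `n`: a partition of the form `(n - m, 1^m)` with `0 ≤ m < n`. -/
def IsHook {n : ℕ} (lam : n.Partition) : Prop :=
  ∃ m : ℕ, m < n ∧ lam.parts = (n - m) ::ₘ Multiset.replicate m 1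

/-- `lam` is a longest hook partition (one with the largest number of parts) among the hook
partitions with nonzero coefficient. -/
def IsLongestHook {n : ℕ} (a : n.Partition → ℚ) (lam : n.Partition) : Prop :=
  IsHook lam ∧ a lam ≠ 0 ∧
    ∀ mu : n.Partition, IsHook mu → a mu ≠ 0 → mu.parts.card ≤ lam.parts.card

/-- The subgraph `C` of `G` is a cycle. -/
def IsCycleSubgraph {V : Type*} {G : SimpleGraph V} (C : G.Subgraph) : Prop :=
  ∃ (u : V) (p : G.Walk u u), p.IsCycle ∧ p.toSubgraph = C

/-- The subgraph `C` is the one and only cycle of `G`; in particular `G` is unicyclic. -/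
def IsUniqueCycle {V : Type*} {G : SimpleGraph V} (C : G.Subgraph) : Prop :=
  IsCycleSubgraph C ∧ ∀ D : G.Subgraph, IsCycleSubgraph D → D = C

/-- The vertex set of the tree rooted at `v`: the connected component of `v` after the edges of
the cycle `C` have been deleted from `G`. -/
def rootedTreeVerts {V : Type*} {G : SimpleGraph V} (C : G.Subgraph) (v : V) : Set V :=
  {w | (G.deleteEdges C.edgeSet).Reachable v w}

/-- The number of non-trivial rooted trees (trees with more than one vertex) attached to the
cycle `C`. -/
noncomputable def numNontrivialRootedTrees {V : Type*} {G : SimpleGraph V}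
    (C : G.Subgraph) : ℕ :=
  {v ∈ C.verts | (rootedTreeVerts C v).Nontrivial}.ncard

/-- The internal edges: edges both of whose endpoints have degree at least two. -/
def internalEdges {V : Type*} [Fintype V] (G : SimpleGraph V) [DecidableRel G.Adj] :
    Set (Sym2 V) :=
  {e ∈ G.edgeSet | ∀ v ∈ e, 2 ≤ G.degree v}

end SimpleGraph

/-! Inclusion-exclusion over monochromatic edges gives $\mathbf X_G=\sum_{S\subseteq
E}(-1)^{|S|}p_{\lambda(S)}$, where $\lambda(S)$ lists the component sizes of $(V,S)$. For a star
this reads $\mathfrak{st}_{j+1}=\sum_r(-1)^r\binom jr p_{r+1}p_1^{j-r}$. Writing $z^r$ for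
$p_{r+1}$, this is $(p_1-z)^j$; since $z\mapsto p_1-z$ is an involution fixing $p_1$, the same
formula turns power sums back into stars (`starSubst_starSubst`). With the algebraic independence of
the power sums (`psumEval_injective`), the star expansion exists and is unique.

Hook coefficients are isolated by a homomorphism to dual numbers (`hookHom`):
$\mathfrak{st}_1\mapsto1$ and $\mathfrak{st}_{j+1}\mapsto\varepsilon(-t)^j$ for $j\ge1$. As
$\varepsilon^2=0$, partitions with two parts at least 2 vanish. Since
$p_{j+1}\mapsto1+\varepsilon((1+t)^j-1)$, products over components become sums, and $\mathbf
X_G\mapsto\varepsilon F(t)$, where $F$ (`hookPoly`) sums $(1+t)^{|B|-1}-1$ over vertex sets $B$,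
weighted by the signed number of edge subsets having $B$ as a component.

An edge outside $B$ can be toggled, so that weight vanishes unless $V\setminus B$ is independent. In
a connected unicyclic graph an edge count then leaves only $V\setminus B=T$ or $T\cup\{v\}$, with
$T$ a set of leaves and $v$ a cycle vertex of degree 2; there are $c-r$ such $v$. With $l\ge 1$
leaves and $k=n-l=m+2$, summing over $T$ by the binomial theorem gives
$F=(-t)^l(-(1+t))^m\bigl[(c-1)(-(1+t))+(c-r)\bigr]$, with constant corrections when $l=0$. The
lowest nonconstant term of $F$ gives the longest hook: degree $l$ if $r\ge2$, degree $l+1$ if $r=1$,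
and degree 1 if $G$ is a cycle. -/

/-! ### Power sums and the edge-subset expansion of the chromatic symmetric function. -/

/-- The power sum `p_j = ∑ i, x_i ^ j` (for `j ≥ 1`). -/
noncomputable def psumSeries (j : ℕ) : MvPowerSeries ℕ ℚ :=
  open Classical in fun d => if ∃ i, d = Finsupp.single i j then 1 else 0

theorem finite_sum_single {ι : Type*} [Fintype ι] (w : ι → ℕ) (hw : ∀ i, w i ≠ 0) (d : ℕ →₀ ℕ) :
    Finite {f : ι → ℕ // ∑ i, Finsupp.single (f i) (w i) = d} := by
  have key : ∀ (f : {f : ι → ℕ // ∑ i, Finsupp.single (f i) (w i) = d}) (i : ι),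
      f.1 i ∈ d.support := by
    rintro ⟨f, rfl⟩ i
    rw [Finsupp.mem_support_iff, Finsupp.finsetSum_apply]
    have h : w i ≤ ∑ j, (Finsupp.single (f j) (w j) : ℕ →₀ ℕ) (f i) := by
      refine le_trans ?_ (Finset.single_le_sum
        (f := fun j => (Finsupp.single (f j) (w j) : ℕ →₀ ℕ) (f i))
        (fun _ _ => Nat.zero_le _) (Finset.mem_univ i))
      simp
    exact ((Nat.pos_of_ne_zero (hw i)).trans_le h).ne'
  refine Finite.of_injective (β := ι → d.support) (fun f i => ⟨f.1 i, key f i⟩) ?_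
  intro f g h
  ext i
  exact congrArg Subtype.val (congrFun h i)

/-- A term of the expanded product picks one variable for each factor. Because `w i ≠ 0`, the
monomial $x_c^{w_i}$ determines $c$, so terms and functions `f` correspond bijectively. -/
theorem coeff_prod_psumSeries {ι : Type*} [Fintype ι] (w : ι → ℕ) (hw : ∀ i, w i ≠ 0)
    (d : ℕ →₀ ℕ) : MvPowerSeries.coeff d (∏ i, psumSeries (w i)) =
      (Nat.card {f : ι → ℕ // ∑ i, Finsupp.single (f i) (w i) = d} : ℚ) := by
  classical
  rw [MvPowerSeries.coeff_prod]
  have h1 : ∀ l : ι →₀ (ℕ →₀ ℕ), ∏ i, MvPowerSeries.coeff (l i) (psumSeries (w i)) =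
      if ∀ i, ∃ c, l i = Finsupp.single c (w i) then (1 : ℚ) else 0 := by
    intro l
    have : ∀ i, MvPowerSeries.coeff (l i) (psumSeries (w i)) =
        if ∃ c, l i = Finsupp.single c (w i) then (1 : ℚ) else 0 := fun i => by
      change psumSeries (w i) (l i) = _
      unfold psumSeries
      congr
    simp_rw [this]
    rw [Finset.prod_ite_zero]
    simp
  simp_rw [h1]
  rw [Finset.sum_boole, ← Fintype.card_coe, ← Nat.card_eq_fintype_card]
  refine congrArg (fun m : ℕ => (m : ℚ)) (Nat.card_congr (Equiv.ofBijective
    (fun f => ⟨Finsupp.equivFunOnFinite.symm (fun i => Finsupp.single (f.1 i) (w i)), ?_⟩)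
    ⟨?_, ?_⟩)).symm
  rotate_left 2
  · rw [Finset.mem_filter, Finset.mem_finsuppAntidiag]
    exact ⟨⟨f.2, Finset.subset_univ _⟩, fun i => ⟨f.1 i, rfl⟩⟩
  · rintro ⟨f, hf⟩ ⟨g, hg⟩ h
    ext i
    have h2 := DFunLike.congr_fun (congrArg Subtype.val h) i
    exact Finsupp.single_left_injective (hw i) h2
  · rintro ⟨l, hl⟩
    rw [Finset.mem_filter, Finset.mem_finsuppAntidiag] at hl
    obtain ⟨⟨hl, -⟩, hc⟩ := hl
    choose f hf using hc
    refine ⟨⟨f, by simpa only [← hf] using hl⟩, ?_⟩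
    ext1
    ext1 i
    exact (hf i).symm

/-- A colouring constant on the fibres of `q` is a function on `ι`, and a fibre of size $s$ given
colour $c$ contributes $x_c^s$. -/
theorem coeff_prod_psumSeries_fiber {V ι : Type*} [Fintype V] [Fintype ι] [DecidableEq ι]
    (q : V → ι) (hq : Function.Surjective q) (d : ℕ →₀ ℕ) :
    MvPowerSeries.coeff d (∏ i, psumSeries (Finset.univ.filter (fun v => q v = i)).card) =
      (Nat.card {κ : V → ℕ // (∀ u v, q u = q v → κ u = κ v) ∧
        ∑ v, Finsupp.single (κ v) 1 = d} : ℚ) := by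
  rw [coeff_prod_psumSeries]
  swap
  · intro i
    obtain ⟨v, hv⟩ := hq i
    exact (Finset.card_pos.2 ⟨v, by simpa using hv⟩).ne'
  have hsum : ∀ f : ι → ℕ, ∑ v, Finsupp.single (f (q v)) 1 =
      ∑ i, Finsupp.single (f i) (Finset.univ.filter (fun v => q v = i)).card := by
    intro f
    rw [← Finset.sum_fiberwise (g := q)]
    refine Finset.sum_congr rfl fun i _ => ?_
    rw [Finset.sum_congr rfl (g := fun _ => Finsupp.single (f i) 1)]
    · simp
    · intro v hv
      rw [(Finset.mem_filter.1 hv).2]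
  congr 1
  refine Nat.card_congr (Equiv.ofBijective
    (fun f => ⟨fun v => f.1 (q v), fun u v h => by simp only [h], by rw [hsum]; exact f.2⟩) ⟨?_, ?_⟩)
  · rintro ⟨f, hf⟩ ⟨g, hg⟩ h
    ext i
    obtain ⟨v, rfl⟩ := hq i
    exact congrFun (congrArg Subtype.val h) v
  · rintro ⟨κ, hκ, hd⟩
    have h : ∀ v, κ (Function.surjInv hq (q v)) = κ v := fun v =>
      hκ _ _ (Function.surjInv_eq hq _)
    refine ⟨⟨fun i => κ (Function.surjInv hq i), ?_⟩, ?_⟩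
    · rw [← hsum, ← hd]
      simp only [h]
    · ext v
      exact h v

/-- The coefficients of the chromatic symmetric function over edge subsets, by
inclusion-exclusion on the set of monochromatic edges. -/
theorem SimpleGraph.coeff_chromaticSymm {V : Type*} [Fintype V] (G : SimpleGraph V)
    (E : Finset (Sym2 V)) (hE : (E : Set (Sym2 V)) = G.edgeSet) (d : ℕ →₀ ℕ) :
    MvPowerSeries.coeff d G.chromaticSymm = ∑ S ∈ E.powerset, (-1 : ℚ) ^ S.card *
      (Nat.card {κ : V → ℕ // (∀ u v, s(u, v) ∈ S → κ u = κ v) ∧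
        ∑ v, Finsupp.single (κ v) 1 = d} : ℚ) := by
  classical
  have := finite_sum_single (fun _ : V => 1) (by simp) d
  let α := {κ : V → ℕ // ∑ v, Finsupp.single (κ v) 1 = d}
  have : Finite α := this
  have : Fintype α := Fintype.ofFinite α
  -- `M e` consists of the colour assignments, with the prescribed monomial, that make `e`
  -- monochromatic; proper colourings lie in the complement of every `M e`.
  let M : Sym2 V → Finset α := fun e => Finset.univ.filter fun κ => ∀ u v, s(u, v) = e → κ.1 u = κ.1 v
  have key := Finset.inclusion_exclusion_card_inf_compl E M
  have hl : (Nat.card {κ : G.Coloring ℕ // ∑ v : V, Finsupp.single (κ v) 1 = d}) =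
      (E.inf fun i => (M i)ᶜ).card := by
    rw [← Fintype.card_coe, ← Nat.card_eq_fintype_card]
    refine Nat.card_congr (Equiv.ofBijective (fun κ => ⟨⟨κ.1, κ.2⟩, ?_⟩) ⟨?_, ?_⟩)
    · rw [Finset.mem_inf]
      intro e he
      induction e with | h u v =>
      have : G.Adj u v := by
        have : s(u, v) ∈ (E : Set (Sym2 V)) := he
        rwa [hE] at this
      simp only [M, Finset.compl_filter, Finset.mem_filter, Finset.mem_univ, true_and]
      intro h
      exact κ.1.valid this (h u v rfl)
    · rintro ⟨κ, h⟩ ⟨κ', h'⟩ hh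
      apply Subtype.ext
      apply RelHom.ext
      intro v
      exact congrFun (congrArg (fun x => x.1.1) hh) v
    · rintro ⟨⟨κ, hd⟩, hκ⟩
      rw [Finset.mem_inf] at hκ
      refine ⟨⟨SimpleGraph.Coloring.mk κ ?_, hd⟩, rfl⟩
      intro u v huv h
      have : s(u, v) ∈ (E : Set (Sym2 V)) := hE ▸ huv
      have := hκ _ this
      simp only [M, Finset.compl_filter, Finset.mem_filter, Finset.mem_univ, true_and] at this
      apply this
      intro a b hab
      rcases Sym2.eq_iff.1 hab with ⟨rfl, rfl⟩ | ⟨rfl, rfl⟩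
      exacts [h, h.symm]
  have hr : ∀ S : Finset (Sym2 V), (S.inf M).card = Nat.card {κ : V → ℕ //
      (∀ u v, s(u, v) ∈ S → κ u = κ v) ∧ ∑ v, Finsupp.single (κ v) 1 = d} := by
    intro S
    rw [← Fintype.card_coe, ← Nat.card_eq_fintype_card]
    have hm : ∀ κ : α, κ ∈ S.inf M ↔ ∀ u v, s(u, v) ∈ S → κ.1 u = κ.1 v := by
      intro κ
      simp only [Finset.mem_inf, M, Finset.mem_filter, Finset.mem_univ, true_and]
      exact ⟨fun h u v huv => h _ huv u v rfl, fun h e he u v huv => h u v (huv ▸ he)⟩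
    exact Nat.card_congr
      { toFun := fun κ => ⟨κ.1.1, (hm _).1 κ.2, κ.1.2⟩
        invFun := fun κ => ⟨⟨κ.1, κ.2.2⟩, (hm _).2 κ.2.1⟩
        left_inv := fun _ => rfl
        right_inv := fun _ => rfl }
  change ((Nat.card {κ : G.Coloring ℕ // ∑ v : V, Finsupp.single (κ v) 1 = d} : ℕ) : ℚ) = _
  rw [hl]
  simp_rw [← hr]
  exact_mod_cast congrArg (Int.cast : ℤ → ℚ) key

/-- The family `P` stays abstract so that it can be instantiated both by connected components of a
general graph and by the explicit blocks of a star. -/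
theorem SimpleGraph.chromaticSymm_eq_sum {V : Type*} [Fintype V] (G : SimpleGraph V)
    (E : Finset (Sym2 V)) (hE : (E : Set (Sym2 V)) = G.edgeSet)
    (P : Finset (Sym2 V) → MvPowerSeries ℕ ℚ)
    (hP : ∀ S ⊆ E, ∀ d, MvPowerSeries.coeff d (P S) =
      (Nat.card {κ : V → ℕ // (∀ u v, s(u, v) ∈ S → κ u = κ v) ∧
        ∑ v, Finsupp.single (κ v) 1 = d} : ℚ)) :
    G.chromaticSymm = ∑ S ∈ E.powerset, (-1 : ℚ) ^ S.card • P S := by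
  ext d
  rw [G.coeff_chromaticSymm E hE, map_sum]
  refine Finset.sum_congr rfl fun S hS => ?_
  rw [map_smul, hP S (Finset.mem_powerset.1 hS), smul_eq_mul]

open scoped Classical in
theorem SimpleGraph.chromaticSymm_eq_sum_components {V : Type*} [Fintype V] (G : SimpleGraph V)
    (E : Finset (Sym2 V)) (hE : (E : Set (Sym2 V)) = G.edgeSet) :
    G.chromaticSymm = ∑ S ∈ E.powerset, (-1 : ℚ) ^ S.card •
      ∏ c : (SimpleGraph.fromEdgeSet (S : Set (Sym2 V))).ConnectedComponent,
        psumSeries (Finset.univ.filter (fun v => v ∈ c.supp)).card := by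
  refine G.chromaticSymm_eq_sum E hE _ fun S hS d => ?_
  have := coeff_prod_psumSeries_fiber
    (fun v => (SimpleGraph.fromEdgeSet (S : Set (Sym2 V))).connectedComponentMk v)
    Quot.mk_surjective d
  simp only [SimpleGraph.ConnectedComponent.mem_supp_iff]
  rw [this]
  refine congrArg (fun m : ℕ => (m : ℚ)) (Nat.card_congr
    (Equiv.subtypeEquivRight fun κ => and_congr_left fun _ => ⟨?_, ?_⟩))
  swap
  · intro h u v huv
    obtain ⟨p⟩ := SimpleGraph.ConnectedComponent.exact huv
    induction p with
    | nil => rfl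
    | cons hadj p ih =>
      refine (h _ _ ?_).trans (ih (SimpleGraph.ConnectedComponent.sound ⟨p⟩))
      rw [SimpleGraph.fromEdgeSet_adj] at hadj
      exact hadj.1
  · intro h u v huv
    by_cases e : u = v
    · rw [e]
    · exact h u v (SimpleGraph.ConnectedComponent.sound
        (SimpleGraph.Adj.reachable (by simp [e, huv])))

-- Choosing $r$ of the $k$ edges merges the centre with $r$ leaves into a block of size $r+1$ and
-- leaves $k-r$ singletons.
open scoped Classical in
theorem SimpleGraph.starSymm_succ (k : ℕ) : SimpleGraph.starSymm (k + 1) =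
    ∑ r ∈ Finset.range (k + 1), ((-1 : ℚ) ^ r * (k.choose r : ℚ)) •
      (psumSeries (r + 1) * psumSeries 1 ^ (k - r)) := by
  let em : Fin k ↪ Sym2 (Fin (k + 1)) := ⟨fun x => s(0, x.succ), by
    intro x y h
    simpa using h⟩
  let E : Finset (Sym2 (Fin (k + 1))) := Finset.univ.map em
  have hE : (E : Set (Sym2 (Fin (k + 1)))) = (starGraph (0 : Fin (k + 1))).edgeSet := by
    ext e
    induction e with | h u v =>
    simp only [E, em, Finset.coe_map, Finset.coe_univ, Set.image_univ, Set.mem_range,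
      SimpleGraph.mem_edgeSet, SimpleGraph.starGraph_adj]
    constructor
    · rintro ⟨x, hx⟩
      rcases Sym2.eq_iff.1 hx with ⟨rfl, rfl⟩ | ⟨rfl, rfl⟩ <;> simp [Fin.succ_ne_zero, (Fin.succ_ne_zero _).symm]
    · rintro ⟨h, rfl | rfl⟩
      · obtain ⟨x, rfl⟩ := Fin.exists_succ_eq.2 h.symm
        exact ⟨x, rfl⟩
      · obtain ⟨x, rfl⟩ := Fin.exists_succ_eq.2 h
        exact ⟨x, Sym2.eq_swap⟩
  have h := (starGraph (0 : Fin (k + 1))).chromaticSymm_eq_sum E hE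
    (fun S => psumSeries (S.card + 1) * psumSeries 1 ^ (k - S.card)) ?_
  · change (starGraph (0 : Fin (k + 1))).chromaticSymm = _
    rw [h, Finset.sum_powerset_apply_card
      (fun r => (-1 : ℚ) ^ r • (psumSeries (r + 1) * psumSeries 1 ^ (k - r)))]
    simp only [E, Finset.card_map, Finset.card_univ, Fintype.card_fin]
    refine Finset.sum_congr rfl fun r _ => ?_
    rw [← Nat.cast_smul_eq_nsmul ℚ, smul_smul, mul_comm]
  · intro S hS d
    obtain ⟨T, -, rfl⟩ := Finset.subset_map_iff.1 hS
    -- The fibre over `none` is the block of the centre; each leaf outside `T` is its own fibre.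
    let q : Fin (k + 1) → Option {x : Fin k // x ∉ T} :=
      Fin.cons none (fun x => if h : x ∈ T then none else some ⟨x, h⟩)
    have hq : Function.Surjective q := by
      rintro (_ | ⟨x, hx⟩)
      · exact ⟨0, rfl⟩
      · exact ⟨x.succ, by simp [q, hx]⟩
    have h0 : (Finset.univ.filter (fun v => q v = none)).card = T.card + 1 := by
      have : Finset.univ.filter (fun v => q v = none) =
          insert 0 (T.map (Fin.succEmb k)) := by
        ext v
        cases v using Fin.cases with
        | zero => simp [q]
        | succ x => simp [q]
      rw [this, Finset.card_insert_of_notMem (by simp), Finset.card_map]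
    have h1 : ∀ y, (Finset.univ.filter (fun v => q v = some y)).card = 1 := by
      rintro ⟨y, hy⟩
      rw [Finset.card_eq_one]
      refine ⟨y.succ, ?_⟩
      ext v
      cases v using Fin.cases with
      | zero => simp [q, (Fin.succ_ne_zero _).symm]
      | succ x =>
        by_cases hx : x ∈ T
        · simp only [Finset.mem_filter, Finset.mem_univ, true_and, q, Fin.cons_succ, hx,
            Finset.mem_singleton, Fin.succ_inj]
          simp only [dite_true, reduceCtorEq, false_iff]
          rintro rfl
          exact hy hx
        · simp [q, hx]
    have := coeff_prod_psumSeries_fiber q hq d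
    rw [Fintype.prod_option, h0] at this
    simp only [h1, Finset.prod_const, Finset.card_univ] at this
    rw [Fintype.card_subtype_compl, Fintype.card_coe, Fintype.card_fin] at this
    rw [Finset.card_map, this]
    refine congrArg (fun m : ℕ => (m : ℚ)) (Nat.card_congr
      (Equiv.subtypeEquivRight fun κ => and_congr_left fun _ => ⟨?_, ?_⟩))
    swap
    · intro h
      have hz : ∀ v, q v = none → κ v = κ 0 := by
        intro v hv
        cases v using Fin.cases with
        | zero => rfl
        | succ x =>
          refine (h _ _ ?_).symm
          exact Finset.mem_map.2 ⟨x, by simpa [q] using hv, rfl⟩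
      intro u v huv
      cases hu : q u with
      | none => rw [hz u hu, hz v (huv ▸ hu)]
      | some y =>
        have := (Finset.card_eq_one.1 (h1 y))
        obtain ⟨w, hw⟩ := this
        have hu' : u ∈ Finset.univ.filter (fun v => q v = some y) := by simp [hu]
        have hv' : v ∈ Finset.univ.filter (fun v => q v = some y) := by simp [← huv, hu]
        rw [hw, Finset.mem_singleton] at hu' hv'
        rw [hu', hv']
    · intro h u v huv
      apply h
      obtain ⟨x, hx, hxe⟩ := Finset.mem_map.1 huv
      rcases Sym2.eq_iff.1 hxe with ⟨rfl, rfl⟩ | ⟨rfl, rfl⟩ <;> simp [q, hx]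

/-! ### Algebraic independence of power sums and the change of basis to stars. -/

theorem exists_fin_sum_single (d : ℕ →₀ ℕ) :
    ∃ w : Fin d.degree → ℕ, d = ∑ i, Finsupp.single (w i) 1 := by
  obtain ⟨m, w, hw⟩ : ∃ (m : ℕ) (w : Fin m → ℕ), d = ∑ i, Finsupp.single (w i) 1 := by
    refine ⟨d.toMultiset.toList.length, d.toMultiset.toList.get, ?_⟩
    rw [← List.sum_ofFn]
    have : List.ofFn (fun i => Finsupp.single (d.toMultiset.toList.get i) 1) =
        d.toMultiset.toList.map (fun j => (Finsupp.single j 1 : ℕ →₀ ℕ)) := by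
      rw [List.ofFn_comp' d.toMultiset.toList.get (fun j => (Finsupp.single j 1 : ℕ →₀ ℕ)), List.ofFn_get]
    rw [this, ← Multiset.sum_coe, ← Multiset.map_coe, Multiset.coe_toList]
    have h : ∀ s : Multiset ℕ, Multiset.toFinsupp s =
        (s.map fun j => (Finsupp.single j 1 : ℕ →₀ ℕ)).sum := by
      intro s
      induction s using Multiset.induction_on with
      | empty => simp
      | cons a s ih =>
        rw [Multiset.map_cons, Multiset.sum_cons, ← ih, ← Multiset.singleton_add, map_add,
          Multiset.toFinsupp_singleton]
    rw [← h, Finsupp.toMultiset_toFinsupp]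
  have hm : d.degree = m := by
    rw [hw, map_sum]
    simp
  subst hm
  exact ⟨w, hw⟩

/-- Merging parts can only decrease their number, and if the number does not decrease then
nothing was merged. -/
theorem sum_single_eq_of_le {m m' : ℕ} (w g : Fin m → ℕ) (w' f : Fin m' → ℕ)
    (hf : Function.Injective f) (hm : m ≤ m')
    (h : ∑ i, Finsupp.single (g i) (w i + 1) = ∑ j, Finsupp.single (f j) (w' j + 1)) :
    ∑ i, (Finsupp.single (w i) 1 : ℕ →₀ ℕ) = ∑ j, Finsupp.single (w' j) 1 := by
  have hval : ∀ j, (∑ i, Finsupp.single (g i) (w i + 1) : ℕ →₀ ℕ) (f j) = w' j + 1 := by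
    intro j
    rw [h, Finsupp.finsetSum_apply, Finset.sum_eq_single j]
    · simp
    · intro b _ hb
      exact Finsupp.single_eq_of_ne (fun e => hb (hf e).symm)
    · simp
  have hex : ∀ j, ∃ i, g i = f j := by
    intro j
    by_contra hcon
    push Not at hcon
    have := hval j
    rw [Finsupp.finsetSum_apply, Finset.sum_eq_zero] at this
    · omega
    · intro i _
      exact Finsupp.single_eq_of_ne (hcon i).symm
  -- `τ` selects a left-hand part for every occupied variable. It is injective, so `m ≤ m'` makes it
  -- bijective and every variable receives exactly one part.
  choose τ hτ using hex
  have hτi : Function.Injective τ := fun a b hab => hf (by rw [← hτ, ← hτ, hab])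
  have hmm : m = m' := le_antisymm hm (by simpa using Fintype.card_le_of_injective τ hτi)
  subst hmm
  have hτb : Function.Bijective τ := Finite.injective_iff_bijective.1 hτi
  rw [← Function.Bijective.sum_comp hτb]
  refine Finset.sum_congr rfl fun j _ => ?_
  have h1 := hval j
  rw [← Function.Bijective.sum_comp hτb, Finsupp.finsetSum_apply, Finset.sum_eq_single j] at h1
  · rw [hτ, Finsupp.single_eq_same] at h1
    rw [Nat.add_right_cancel h1]
  · intro b _ hb
    rw [hτ]
    exact Finsupp.single_eq_of_ne (fun e => hb (hf e).symm)
  · simp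

section

open MvPolynomial

/-- The evaluation of polynomials in the power sums; the variable `X j` is sent to `p_{j+1}`. -/
noncomputable def psumEval : MvPolynomial ℕ ℚ →ₐ[ℚ] MvPowerSeries ℕ ℚ :=
  aeval fun j => psumSeries (j + 1)

theorem psumEval_monomial {m : ℕ} (w : Fin m → ℕ) (c : ℚ) :
    psumEval (monomial (∑ i, Finsupp.single (w i) 1) c) = c • ∏ i, psumSeries (w i + 1) := by
  rw [MvPolynomial.monomial_sum_index, map_mul, map_prod, ← MvPolynomial.algebraMap_eq,
    AlgHom.commutes, ← Algebra.smul_def]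
  refine congrArg _ (Finset.prod_congr rfl fun i _ => ?_)
  exact aeval_X _ _

/-- The power sums are algebraically independent. -/
theorem psumEval_injective : Function.Injective psumEval := by
  rw [injective_iff_map_eq_zero]
  intro P hP
  by_contra hne
  obtain ⟨d₀, hd₀, hmax⟩ := P.support.exists_max_image (fun d => d.degree)
    (MvPolynomial.support_nonempty.2 hne)
  obtain ⟨w₀, hw₀⟩ := exists_fin_sum_single d₀
  -- `e` puts the parts encoded by `d₀` on distinct variables. Since `d₀` has the largest number of
  -- parts in the support, no other term of `P` contributes to this coefficient.
  set e : ℕ →₀ ℕ := ∑ j : Fin d₀.degree, Finsupp.single (j : ℕ) (w₀ j + 1) with he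
  have hcoeff : ∀ (m : ℕ) (w : Fin m → ℕ), MvPowerSeries.coeff e (∏ i, psumSeries (w i + 1)) =
      (Nat.card {f : Fin m → ℕ // ∑ i, Finsupp.single (f i) (w i + 1) = e} : ℚ) :=
    fun m w => coeff_prod_psumSeries _ (by simp) e
  have h0 : MvPowerSeries.coeff e (psumEval P) = 0 := by rw [hP, map_zero]
  rw [P.as_sum, map_sum, map_sum, Finset.sum_eq_single d₀] at h0
  · rw [hw₀, psumEval_monomial, map_smul, ← hw₀, hcoeff, smul_eq_mul, mul_eq_zero] at h0
    rcases h0 with h0 | h0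
    · exact (MvPolynomial.mem_support_iff.1 hd₀) h0
    · have := finite_sum_single (fun i => w₀ i + 1) (by simp) e
      have : Nonempty {f : Fin d₀.degree → ℕ // ∑ i, Finsupp.single (f i) (w₀ i + 1) = e} :=
        ⟨fun j => j, rfl⟩
      exact Nat.card_pos.ne' (Nat.cast_eq_zero.1 h0)
  · intro d hd hdne
    obtain ⟨w, hw⟩ := exists_fin_sum_single d
    rw [hw, psumEval_monomial, map_smul, hcoeff, Nat.card_eq_zero.2, Nat.cast_zero, smul_zero]
    left
    constructor
    rintro ⟨g, hg⟩
    apply hdne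
    rw [hw, hw₀]
    exact sum_single_eq_of_le w g w₀ (fun j => j) Fin.val_injective (hmax d hd) hg
  · intro h
    exact absurd hd₀ h

/-- The change of variables expressing stars by power sums, and conversely. -/
noncomputable def starSubst : MvPolynomial ℕ ℚ →ₐ[ℚ] MvPolynomial ℕ ℚ :=
  aeval fun j => ∑ r ∈ Finset.range (j + 1), ((-1 : ℚ) ^ r * (j.choose r : ℚ)) •
    (X r * X 0 ^ (j - r))

theorem starSubst_X (j : ℕ) : starSubst (X j) =
    ∑ r ∈ Finset.range (j + 1), ((-1 : ℚ) ^ r * (j.choose r : ℚ)) • (X r * X 0 ^ (j - r)) := by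
  rw [starSubst, aeval_X]

/-- The linear map sending `z ^ r` to `X r`. -/
noncomputable def umbral : Polynomial (MvPolynomial ℕ ℚ) →ₗ[MvPolynomial ℕ ℚ] MvPolynomial ℕ ℚ :=
  Polynomial.lsum fun r => LinearMap.mulRight _ (X r)

theorem umbral_X_pow (r : ℕ) : umbral (Polynomial.X ^ r) = X r := by
  rw [umbral, Polynomial.lsum_apply, ← Polynomial.monomial_one_right_eq_X_pow,
    Polynomial.sum_monomial_index] <;> simp

theorem umbral_C_sub_X_pow (j : ℕ) :
    umbral ((Polynomial.C (X 0) - Polynomial.X) ^ j) = starSubst (X j) := by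
  rw [starSubst_X, sub_eq_neg_add, add_pow, map_sum]
  refine Finset.sum_congr rfl fun r _ => ?_
  have : ((-Polynomial.X : Polynomial (MvPolynomial ℕ ℚ)) ^ r * Polynomial.C (X 0) ^ (j - r) *
      (j.choose r : Polynomial (MvPolynomial ℕ ℚ))) =
      (((-1) ^ r * X 0 ^ (j - r) * (j.choose r : MvPolynomial ℕ ℚ)) • Polynomial.X ^ r) := by
    rw [Polynomial.smul_eq_C_mul, neg_pow]
    simp only [map_mul, map_pow, map_neg, map_one, map_natCast]
    ring
  rw [this, map_smul, umbral_X_pow, MvPolynomial.smul_eq_C_mul, smul_eq_mul]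
  simp only [map_mul, map_pow, map_neg, map_one, map_natCast]
  ring

/-- Umbrally the star variable is $(X_0-z)^j$. Expanding $z^j=(-(X_0-z)+X_0)^j$ has the same
coefficients as the substitution itself, and $X_0$ is fixed. -/
theorem starSubst_starSubst_X (j : ℕ) : starSubst (starSubst (X j)) = X j := by
  have h0 : starSubst (X 0) = X 0 := by simp [starSubst_X]
  have h : (Polynomial.X : Polynomial (MvPolynomial ℕ ℚ)) ^ j =
      ∑ r ∈ Finset.range (j + 1), ((-1 : MvPolynomial ℕ ℚ) ^ r * X 0 ^ (j - r) *
        (j.choose r : MvPolynomial ℕ ℚ)) • (Polynomial.C (X 0) - Polynomial.X) ^ r := by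
    have : (Polynomial.X : Polynomial (MvPolynomial ℕ ℚ)) =
      -(Polynomial.C (X 0) - Polynomial.X) + Polynomial.C (X 0) := by ring
    conv_lhs => rw [this, add_pow]
    refine Finset.sum_congr rfl fun r _ => ?_
    rw [Polynomial.smul_eq_C_mul, neg_pow]
    generalize Polynomial.C (X 0 : MvPolynomial ℕ ℚ) - Polynomial.X = Y
    simp only [map_mul, map_pow, map_neg, map_one, map_natCast]
    ring
  conv_rhs => rw [← umbral_X_pow, h, map_sum]
  conv_lhs => rw [starSubst_X, map_sum]
  refine Finset.sum_congr rfl fun r _ => ?_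
  rw [map_smul, map_smul, umbral_C_sub_X_pow, map_mul, map_pow, h0, MvPolynomial.smul_eq_C_mul,
    smul_eq_mul]
  simp only [map_mul, map_pow, map_neg, map_one, map_natCast]
  ring

theorem starSubst_starSubst (P : MvPolynomial ℕ ℚ) : starSubst (starSubst P) = P := by
  have : starSubst.comp starSubst = AlgHom.id ℚ _ := by
    ext1 j
    exact starSubst_starSubst_X j
  exact DFunLike.congr_fun this P

/-- The evaluation of polynomials in the stars; the variable `X j` is sent to `st_{j+1}`. -/
noncomputable def starEval : MvPolynomial ℕ ℚ →ₐ[ℚ] MvPowerSeries ℕ ℚ :=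
  aeval fun j => SimpleGraph.starSymm (j + 1)

theorem starEval_eq (P : MvPolynomial ℕ ℚ) : starEval P = psumEval (starSubst P) := by
  have : starEval = psumEval.comp starSubst := by
    ext1 j
    simp [starEval, starSubst_X, SimpleGraph.starSymm_succ, psumEval]
  exact DFunLike.congr_fun this P

theorem starEval_injective : Function.Injective starEval := by
  intro P Q h
  rw [starEval_eq, starEval_eq] at h
  rw [← starSubst_starSubst P, psumEval_injective h, starSubst_starSubst]

end

/-! ### Partitions as monomials; existence and uniqueness of the star expansion. -/

section

open MvPolynomial

/-- The monomial `∏ X_{λ_i - 1}` indexing `st_λ`. -/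
noncomputable def partMonomial {n : ℕ} (lam : n.Partition) : MvPolynomial ℕ ℚ :=
  (lam.parts.map fun j => X (j - 1)).prod

/-- The exponent of `partMonomial`. -/
noncomputable def partExponent {n : ℕ} (lam : n.Partition) : ℕ →₀ ℕ :=
  Multiset.toFinsupp (lam.parts.map fun j => j - 1)

theorem partMonomial_eq_monomial {n : ℕ} (lam : n.Partition) :
    partMonomial lam = monomial (partExponent lam) 1 := by
  have h : ∀ s : Multiset ℕ, (s.map fun j => (X j : MvPolynomial ℕ ℚ)).prod =
      monomial (Multiset.toFinsupp s) 1 := by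
    intro s
    induction s using Multiset.induction_on with
    | empty => simp
    | cons a s ih =>
      rw [Multiset.map_cons, Multiset.prod_cons, ih, ← Multiset.singleton_add a s, map_add,
        Multiset.toFinsupp_singleton, X, monomial_mul, one_mul]
  rw [partMonomial, partExponent, ← h, Multiset.map_map]
  rfl

theorem partExponent_injective {n : ℕ} :
    Function.Injective (partExponent : n.Partition → ℕ →₀ ℕ) := by
  intro lam mu h
  have h1 := Multiset.toFinsupp.injective h
  have h2 : ∀ l : n.Partition, (l.parts.map fun j => j - 1).map (fun j => j + 1) = l.parts := by
    intro l
    rw [Multiset.map_map]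
    conv_rhs => rw [← Multiset.map_id l.parts]
    refine Multiset.map_congr rfl fun j hj => ?_
    have := l.parts_pos hj
    simp only [Function.comp, id]
    omega
  ext1
  rw [← h2 lam, h1, h2 mu]

theorem exists_partExponent_eq {n : ℕ} (d : ℕ →₀ ℕ)
    (hd : Finsupp.weight (fun i : ℕ => i + 1) d = n) :
    ∃ lam : n.Partition, partExponent lam = d := by
  refine ⟨⟨d.toMultiset.map fun j => j + 1, ?_, ?_⟩, ?_⟩
  · intro i hi
    obtain ⟨j, -, rfl⟩ := Multiset.mem_map.1 hi
    omega
  · have h : ∀ s : Multiset ℕ, (s.map fun j => j + 1).sum =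
        Finsupp.weight (fun i : ℕ => i + 1) (Multiset.toFinsupp s) := by
      intro s
      induction s using Multiset.induction_on with
      | empty => simp
      | cons a s ih =>
        rw [Multiset.map_cons, Multiset.sum_cons, ih, ← Multiset.singleton_add a s, map_add,
          Multiset.toFinsupp_singleton, map_add, Finsupp.weight_single]
        simp
    rw [h, Finsupp.toMultiset_toFinsupp, hd]
  · simp [partExponent, Multiset.map_map]

theorem starEval_partMonomial {n : ℕ} (lam : n.Partition) :
    starEval (partMonomial lam) = SimpleGraph.starSymmPart lam := by
  rw [partMonomial, map_multiset_prod, Multiset.map_map, SimpleGraph.starSymmPart]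
  refine congrArg _ (Multiset.map_congr rfl fun j hj => ?_)
  have := lam.parts_pos hj
  simp only [Function.comp, starEval, aeval_X]
  congr 1
  omega

theorem coeff_sum_partMonomial {n : ℕ} (a : n.Partition → ℚ) (lam : n.Partition) :
    coeff (partExponent lam) (∑ mu : n.Partition, a mu • partMonomial mu) = a lam := by
  classical
  rw [coeff_sum, Finset.sum_eq_single lam]
  · rw [partMonomial_eq_monomial]
    simp
  · intro mu _ hne
    rw [partMonomial_eq_monomial, coeff_smul, coeff_monomial,
      if_neg (fun h => hne (partExponent_injective h)), smul_zero]
  · simp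

theorem eq_sum_partMonomial {n : ℕ} (P : MvPolynomial ℕ ℚ)
    (hP : IsWeightedHomogeneous (fun i : ℕ => i + 1) P n) :
    P = ∑ mu : n.Partition, coeff (partExponent mu) P • partMonomial mu := by
  classical
  ext d
  by_cases h : ∃ lam : n.Partition, partExponent lam = d
  · obtain ⟨lam, rfl⟩ := h
    rw [coeff_sum_partMonomial (fun mu => coeff (partExponent mu) P)]
  · have h0 : coeff d P = 0 := by
      by_contra hne
      exact h (exists_partExponent_eq d (hP hne))
    rw [h0, coeff_sum, Finset.sum_eq_zero]
    intro mu _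
    rw [partMonomial_eq_monomial, coeff_smul, coeff_monomial, if_neg (fun e => h ⟨mu, e⟩),
      smul_zero]

theorem starSubst_X_isWeightedHomogeneous (j : ℕ) :
    IsWeightedHomogeneous (fun i : ℕ => i + 1) (starSubst (X j)) (j + 1) := by
  rw [starSubst_X, ← mem_weightedHomogeneousSubmodule]
  refine Submodule.sum_mem _ fun r hr => Submodule.smul_mem _ _ ?_
  rw [mem_weightedHomogeneousSubmodule]
  have h := (isWeightedHomogeneous_X ℚ (fun i : ℕ => i + 1) r).mul
    ((isWeightedHomogeneous_X ℚ (fun i : ℕ => i + 1) 0).pow (j - r))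
  convert h using 1
  have := Finset.mem_range.1 hr
  simp
  omega

open scoped Classical in
/-- The chromatic symmetric function as a polynomial in the power sums `X j = p_{j+1}`. -/
noncomputable def chromaticPoly {V : Type*} [Fintype V] (E : Finset (Sym2 V)) :
    MvPolynomial ℕ ℚ :=
  ∑ S ∈ E.powerset, (-1 : ℚ) ^ S.card •
    ∏ c : (SimpleGraph.fromEdgeSet (S : Set (Sym2 V))).ConnectedComponent,
      X ((Finset.univ.filter (fun v => v ∈ c.supp)).card - 1)

theorem card_supp_pos {V : Type*} [Fintype V] {H : SimpleGraph V} (c : H.ConnectedComponent)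
    [DecidablePred (· ∈ c.supp)] :
    0 < (Finset.univ.filter (fun v => v ∈ c.supp)).card := by
  obtain ⟨v, hv⟩ := c.nonempty_supp
  exact Finset.card_pos.2 ⟨v, by simpa using hv⟩

theorem psumEval_chromaticPoly {V : Type*} [Fintype V] (G : SimpleGraph V)
    (E : Finset (Sym2 V)) (hE : (E : Set (Sym2 V)) = G.edgeSet) :
    psumEval (chromaticPoly E) = G.chromaticSymm := by
  classical
  rw [G.chromaticSymm_eq_sum_components E hE, chromaticPoly, map_sum]
  refine Finset.sum_congr rfl fun S _ => ?_
  rw [map_smul, map_prod]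
  refine congrArg _ (Finset.prod_congr rfl fun c _ => ?_)
  rw [psumEval, aeval_X, Nat.sub_add_cancel (Nat.succ_le_of_lt (card_supp_pos c))]

/-- Because `starSubst` is an involution, it also rewrites power sums in terms of stars, so
`starSubst (chromaticPoly E)` is the star expansion as a polynomial. -/
theorem starEval_starSubst_chromaticPoly {V : Type*} [Fintype V] (G : SimpleGraph V)
    (E : Finset (Sym2 V)) (hE : (E : Set (Sym2 V)) = G.edgeSet) :
    starEval (starSubst (chromaticPoly E)) = G.chromaticSymm := by
  rw [starEval_eq, starSubst_starSubst, psumEval_chromaticPoly G E hE]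

open scoped Classical in
theorem starSubst_chromaticPoly_isWeightedHomogeneous {V : Type*} [Fintype V]
    (E : Finset (Sym2 V)) : IsWeightedHomogeneous (fun i : ℕ => i + 1)
      (starSubst (chromaticPoly E)) (Fintype.card V) := by
  rw [chromaticPoly, map_sum, ← mem_weightedHomogeneousSubmodule]
  refine Submodule.sum_mem _ fun S _ => ?_
  rw [map_smul, map_prod]
  refine Submodule.smul_mem _ _ ?_
  rw [mem_weightedHomogeneousSubmodule]
  have h := IsWeightedHomogeneous.prod Finset.univ
    (fun c : (SimpleGraph.fromEdgeSet (S : Set (Sym2 V))).ConnectedComponent =>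
      starSubst (X ((Finset.univ.filter (fun v => v ∈ c.supp)).card - 1))) _
    (fun c _ => starSubst_X_isWeightedHomogeneous _)
  convert h using 1
  rw [← Finset.card_univ, Finset.card_eq_sum_card_fiberwise
    (f := fun v => (SimpleGraph.fromEdgeSet (S : Set (Sym2 V))).connectedComponentMk v)
    (t := Finset.univ) (by simp)]
  refine Finset.sum_congr rfl fun c _ => ?_
  rw [Nat.sub_add_cancel (Nat.succ_le_of_lt (card_supp_pos c))]
  simp [SimpleGraph.ConnectedComponent.mem_supp_iff]

/-- Injectivity of `starEval` moves the question from power series to polynomials, where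
coefficients can be compared and `hookHom` applied. -/
theorem isStarExpansion_iff {V : Type*} [Fintype V] (G : SimpleGraph V)
    (E : Finset (Sym2 V)) (hE : (E : Set (Sym2 V)) = G.edgeSet) {n : ℕ} (a : n.Partition → ℚ) :
    G.IsStarExpansion a ↔
      starSubst (chromaticPoly E) = ∑ lam : n.Partition, a lam • partMonomial lam := by
  rw [SimpleGraph.IsStarExpansion, ← starEval_injective.eq_iff,
    starEval_starSubst_chromaticPoly G E hE, map_sum]
  simp only [map_smul, starEval_partMonomial]

theorem existsUnique_isStarExpansion {V : Type*} [Fintype V] (G : SimpleGraph V) {n : ℕ}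
    (hn : Fintype.card V = n) : ∃! a : n.Partition → ℚ, G.IsStarExpansion a := by
  classical
  subst hn
  have hE : ((Set.toFinite G.edgeSet).toFinset : Set (Sym2 V)) = G.edgeSet := by simp
  refine ⟨fun mu => coeff (partExponent mu)
    (starSubst (chromaticPoly (Set.toFinite G.edgeSet).toFinset)), ?_, ?_⟩
  · refine (isStarExpansion_iff G _ hE _).2 ?_
    exact eq_sum_partMonomial _ (starSubst_chromaticPoly_isWeightedHomogeneous _)
  · intro b hb
    rw [isStarExpansion_iff G _ hE] at hb
    funext mu
    rw [hb, coeff_sum_partMonomial]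

/-! ### Extracting hook coefficients with dual numbers. -/

/-- Reduction modulo the products `st_i st_j` with `i, j ≥ 2` and `st_1 = 1`, in which `st_{j+1}`
becomes `ε (-t) ^ j`. -/
noncomputable def hookHom : MvPolynomial ℕ ℚ →ₐ[ℚ] DualNumber (Polynomial ℚ) :=
  aeval fun j => TrivSqZeroExt.inl (if j = 0 then 1 else 0) +
    TrivSqZeroExt.inr ((-Polynomial.X) ^ j - if j = 0 then 1 else 0)

theorem hookHom_X (j : ℕ) : hookHom (X j) = TrivSqZeroExt.inl (if j = 0 then 1 else 0) +
    TrivSqZeroExt.inr ((-Polynomial.X) ^ j - if j = 0 then 1 else 0) := by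
  rw [hookHom, aeval_X]

theorem hookHom_X_zero : hookHom (X 0) = 1 := by
  rw [hookHom_X]
  ext <;> simp

theorem hookHom_X_of_ne_zero {j : ℕ} (hj : j ≠ 0) :
    hookHom (X j) = TrivSqZeroExt.inr ((-Polynomial.X) ^ j) := by
  rw [hookHom_X]
  ext <;> simp [hj]

/-- The signs in the star formula cancel those of $(-t)^r$, leaving the binomial expansion of
$(1+t)^j$. The $-1$ comes from the $r=0$ term, because $\mathfrak{st}_1$ goes to $1$ and not to
$1+\varepsilon$. -/
theorem hookHom_starSubst_X (j : ℕ) :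
    hookHom (starSubst (X j)) = 1 + TrivSqZeroExt.inr ((1 + Polynomial.X) ^ j - 1) := by
  simp only [starSubst_X, map_sum, map_smul, map_mul, map_pow, hookHom_X_zero, one_pow, mul_one]
  simp only [hookHom_X]
  ext1
  · simp only [TrivSqZeroExt.fst_sum, TrivSqZeroExt.fst_smul, TrivSqZeroExt.fst_add,
      TrivSqZeroExt.fst_inl, TrivSqZeroExt.fst_inr, add_zero, TrivSqZeroExt.fst_one, smul_ite,
      smul_zero]
    rw [Finset.sum_ite_eq']
    simp
  · simp only [TrivSqZeroExt.snd_sum, TrivSqZeroExt.snd_smul, TrivSqZeroExt.snd_add,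
      TrivSqZeroExt.snd_inl, TrivSqZeroExt.snd_inr, zero_add, TrivSqZeroExt.snd_one, smul_sub,
      Finset.sum_sub_distrib, smul_ite, smul_zero]
    rw [Finset.sum_ite_eq']
    congr 1
    · rw [add_comm 1 Polynomial.X, add_pow]
      refine Finset.sum_congr rfl fun r _ => ?_
      rw [neg_pow, Polynomial.smul_eq_C_mul]
      simp only [map_mul, map_pow, map_neg, map_one, map_natCast]
      have : (-1 : Polynomial ℚ) ^ r * (-1) ^ r = 1 := by
        rw [← mul_pow]; simp
      linear_combination (j.choose r : Polynomial ℚ) * Polynomial.X ^ r * this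
    · simp

theorem prod_one_add_inr {ι R : Type*} [CommRing R] (s : Finset ι) (u : ι → R) :
    ∏ i ∈ s, (1 + TrivSqZeroExt.inr (u i) : DualNumber R) =
      1 + TrivSqZeroExt.inr (∑ i ∈ s, u i) := by
  classical
  induction s using Finset.induction_on with
  | empty => simp
  | insert a s ha ih =>
    rw [Finset.prod_insert ha, ih, Finset.sum_insert ha]
    ext <;> simp [add_comm]

open scoped Classical in
/-- The generating polynomial of the coefficients of hook shapes. -/
noncomputable def hookPoly {V : Type*} [Fintype V] (E : Finset (Sym2 V)) : Polynomial ℚ :=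
  ∑ S ∈ E.powerset, (-1 : ℚ) ^ S.card •
    ∑ c : (SimpleGraph.fromEdgeSet (S : Set (Sym2 V))).ConnectedComponent,
      ((1 + Polynomial.X) ^ ((Finset.univ.filter (fun v => v ∈ c.supp)).card - 1) - 1)

/-- Each edge subset contributes real part $(-1)^{|S|}$, and these cancel because `E` is nonempty;
only the $\varepsilon$ part survives. -/
theorem hookHom_starSubst_chromaticPoly {V : Type*} [Fintype V] (E : Finset (Sym2 V))
    (hE : E.Nonempty) :
    hookHom (starSubst (chromaticPoly E)) = TrivSqZeroExt.inr (hookPoly E) := by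
  simp only [chromaticPoly, map_sum, map_smul, map_prod, hookHom_starSubst_X, prod_one_add_inr,
    smul_add, Finset.sum_add_distrib]
  have h : ∑ S ∈ E.powerset, (-1 : ℚ) ^ S.card = 0 := by
    have := Finset.sum_powerset_neg_one_pow_card_of_nonempty hE
    exact_mod_cast congrArg (Int.cast : ℤ → ℚ) this
  rw [← Finset.sum_smul, h, zero_smul, zero_add, hookPoly]
  ext1 <;> simp [TrivSqZeroExt.fst_sum, TrivSqZeroExt.snd_sum]

/-- The hook partition `(M + 1, 1, …, 1)` of `n`. -/
def hookPartition (n M : ℕ) (h : M < n) : n.Partition where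
  parts := (M + 1) ::ₘ Multiset.replicate (n - 1 - M) 1
  parts_pos := by
    intro i hi
    rcases Multiset.mem_cons.1 hi with rfl | hi
    · omega
    · rw [Multiset.eq_of_mem_replicate hi]; omega
  parts_sum := by
    simp
    omega

theorem hookPartition_parts (n M : ℕ) (h : M < n) :
    (hookPartition n M h).parts = (M + 1) ::ₘ Multiset.replicate (n - 1 - M) 1 := rfl

theorem Polynomial.coeff_neg_X_pow (M k : ℕ) :
    ((-Polynomial.X : Polynomial ℚ) ^ M).coeff k = if k = M then (-1) ^ M else 0 := by
  rw [neg_pow, ← Polynomial.C_1, ← Polynomial.C_neg, ← Polynomial.C_pow,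
    Polynomial.coeff_C_mul_X_pow]

theorem hookHom_prod_ones (k : ℕ) :
    hookHom ((Multiset.replicate k 1).map fun j => X (j - 1)).prod = 1 := by
  simp [hookHom_X_zero]

/-- Two parts of size at least 2 give a factor $\varepsilon^2=0$; otherwise the multiset has at most
one part different from 1. -/
theorem hookHom_prod_trichotomy (s : Multiset ℕ) (hs : ∀ j ∈ s, 0 < j) :
    s = Multiset.replicate s.card 1 ∨
    (∃ j k, 1 ≤ j ∧ s = (j + 1) ::ₘ Multiset.replicate k 1) ∨
    hookHom (s.map fun j => X (j - 1)).prod = 0 := by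
  induction s using Multiset.induction_on with
  | empty => left; rfl
  | cons a s ih =>
    have ha := hs a (Multiset.mem_cons_self a s)
    rcases ih (fun j hj => hs j (Multiset.mem_cons_of_mem hj)) with h | ⟨j, k, hj, h⟩ | h
    · by_cases h1 : a = 1
      · left
        subst h1
        rw [Multiset.card_cons, Multiset.replicate_succ, ← h]
      · right; left
        refine ⟨a - 1, s.card, by omega, ?_⟩
        rw [← h, Nat.sub_add_cancel ha]
    · by_cases h1 : a = 1
      · right; left
        refine ⟨j, k + 1, hj, ?_⟩
        rw [h, h1, Multiset.replicate_succ, Multiset.cons_swap]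
      · right; right
        rw [h, Multiset.map_cons, Multiset.map_cons, Multiset.prod_cons, Multiset.prod_cons,
          map_mul, map_mul, hookHom_prod_ones, hookHom_X_of_ne_zero (by omega),
          hookHom_X_of_ne_zero (by omega), mul_one, TrivSqZeroExt.inr_mul_inr]
    · right; right
      rw [Multiset.map_cons, Multiset.prod_cons, map_mul, h, mul_zero]

theorem hookHom_partMonomial_hookPartition {n M : ℕ} (h : M < n) (hM : 1 ≤ M) :
    hookHom (partMonomial (hookPartition n M h)) = TrivSqZeroExt.inr ((-Polynomial.X) ^ M) := by
  rw [partMonomial, hookPartition_parts, Multiset.map_cons, Multiset.prod_cons, map_mul,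
    hookHom_prod_ones, mul_one, Nat.add_sub_cancel, hookHom_X_of_ne_zero (by omega)]

theorem partMonomial_trichotomy {n : ℕ} (hn : 0 < n) (lam : n.Partition) :
    lam = hookPartition n 0 hn ∨
    (∃ M, ∃ h : M < n, 1 ≤ M ∧ lam = hookPartition n M h) ∨ hookHom (partMonomial lam) = 0 := by
  rcases hookHom_prod_trichotomy lam.parts (fun j hj => lam.parts_pos hj) with h | ⟨M, k, hM, h⟩ | h
  · left
    have h2 := lam.parts_sum
    ext1
    rw [h, Multiset.sum_replicate] at h2
    rw [h, hookPartition_parts, zero_add, ← Multiset.replicate_succ]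
    congr 1
    simp at h2
    omega
  · right; left
    have h2 := lam.parts_sum
    rw [h, Multiset.sum_cons, Multiset.sum_replicate] at h2
    rw [smul_eq_mul, mul_one] at h2
    refine ⟨M, by omega, hM, ?_⟩
    ext1
    rw [h, hookPartition_parts, show n - 1 - M = k by omega]
  · right; right; exact h

/-- The real part of the image sees only $(1^n)$, and the coefficient of $\varepsilon t^M$ only the
hook with first part $M+1$. The sign undoes the one in $(-t)^M$. -/
theorem isStarExpansion_hook {V : Type*} [Fintype V] (G : SimpleGraph V)
    (E : Finset (Sym2 V)) (hE : (E : Set (Sym2 V)) = G.edgeSet) (hne : E.Nonempty) {n : ℕ}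
    (hn : 0 < n) (a : n.Partition → ℚ) (ha : G.IsStarExpansion a) :
    a (hookPartition n 0 hn) = 0 ∧
    ∀ M (h : M < n), 1 ≤ M → a (hookPartition n M h) = (-1) ^ M * (hookPoly E).coeff M := by
  rw [isStarExpansion_iff G E hE] at ha
  have key := congrArg hookHom ha
  rw [hookHom_starSubst_chromaticPoly E hne, map_sum] at key
  simp only [map_smul] at key
  have h0 : hookHom (partMonomial (hookPartition n 0 hn)) = 1 := by
    rw [partMonomial, hookPartition_parts, zero_add, ← Multiset.replicate_succ, hookHom_prod_ones]
  constructor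
  · have := congrArg TrivSqZeroExt.fst key
    rw [TrivSqZeroExt.fst_inr, TrivSqZeroExt.fst_sum, Finset.sum_eq_single (hookPartition n 0 hn)]
      at this
    · rw [h0, TrivSqZeroExt.fst_smul, TrivSqZeroExt.fst_one, eq_comm, smul_eq_zero] at this
      exact this.resolve_right one_ne_zero
    · intro lam _ hl
      rcases partMonomial_trichotomy hn lam with h | ⟨M, h, hM, rfl⟩ | h
      · exact absurd h hl
      · rw [hookHom_partMonomial_hookPartition h hM]
        simp
      · rw [h]
        simp
    · simp
  · intro M hMn hM
    have := congrArg (fun x => (TrivSqZeroExt.snd x).coeff M) key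
    simp only [TrivSqZeroExt.snd_inr, TrivSqZeroExt.snd_sum, Polynomial.finsetSum_coeff] at this
    rw [Finset.sum_eq_single (hookPartition n M hMn)] at this
    · rw [hookHom_partMonomial_hookPartition hMn hM] at this
      rw [this, TrivSqZeroExt.snd_smul, TrivSqZeroExt.snd_inr, Polynomial.coeff_smul,
        Polynomial.coeff_neg_X_pow, if_pos rfl, smul_eq_mul, mul_left_comm, ← mul_pow]
      simp
    · intro lam _ hl
      rcases partMonomial_trichotomy hn lam with rfl | ⟨M', h, hM', rfl⟩ | h
      · rw [h0]
        simp
      · rw [hookHom_partMonomial_hookPartition h hM', TrivSqZeroExt.snd_smul,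
          TrivSqZeroExt.snd_inr, Polynomial.coeff_smul, Polynomial.coeff_neg_X_pow,
          if_neg, smul_zero]
        rintro rfl
        exact hl rfl
      · rw [h]
        simp
    · simp

theorem isHook_hookPartition {n M : ℕ} (h : M < n) :
    SimpleGraph.IsHook (hookPartition n M h) := by
  refine ⟨n - 1 - M, by omega, ?_⟩
  rw [hookPartition_parts, show n - (n - 1 - M) = M + 1 by omega]

theorem isHook_iff {n : ℕ} (lam : n.Partition) :
    SimpleGraph.IsHook lam ↔ ∃ M, ∃ h : M < n, lam = hookPartition n M h := by
  constructor
  · rintro ⟨m, hm, h⟩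
    refine ⟨n - 1 - m, by omega, ?_⟩
    ext1
    rw [h, hookPartition_parts, show n - 1 - (n - 1 - m) = m by omega,
      show n - 1 - m + 1 = n - m by omega]
  · rintro ⟨M, h, rfl⟩
    exact isHook_hookPartition h

/-- If `M₀ ≥ 1` is the order of vanishing of the sequence of hook coefficients, the longest hook
is `(M₀ + 1, 1, …, 1)`. -/
theorem isLongestHook_iff {n : ℕ} (a : n.Partition → ℚ) {M₀ : ℕ} (h₀ : M₀ < n)
    (hne : a (hookPartition n M₀ h₀) ≠ 0)
    (hlt : ∀ M (h : M < n), M < M₀ → a (hookPartition n M h) = 0) (lam : n.Partition) :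
    SimpleGraph.IsLongestHook a lam ↔ lam = hookPartition n M₀ h₀ := by
  have hcard : ∀ M (h : M < n), (hookPartition n M h).parts.card = n - M := by
    intro M h
    simp [hookPartition_parts]
    omega
  constructor
  · rintro ⟨h1, h2, h3⟩
    obtain ⟨M, h, rfl⟩ := (isHook_iff lam).1 h1
    have h4 := h3 _ (isHook_hookPartition h₀) hne
    rw [hcard, hcard] at h4
    have h5 : ¬ M < M₀ := fun hM => h2 (hlt M h hM)
    have : M = M₀ := by omega
    subst this
    rfl
  · rintro rfl
    refine ⟨isHook_hookPartition h₀, hne, ?_⟩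
    intro mu h1 h2
    obtain ⟨M, h, rfl⟩ := (isHook_iff mu).1 h1
    rw [hcard, hcard]
    have h5 : ¬ M < M₀ := fun hM => h2 (hlt M h hM)
    omega

theorem count_one_hookPartition {n M : ℕ} (h : M < n) (hM : 1 ≤ M) :
    (hookPartition n M h).parts.count 1 = n - 1 - M := by
  rw [hookPartition_parts, Multiset.count_cons_of_ne (by omega), Multiset.count_replicate_self]

end

/-! ### Vertex sets of components and their signed counts. -/

namespace SimpleGraph

variable {V : Type*}

/-- `B` is the vertex set of a connected component of `H`. -/
def IsComponentSet (H : SimpleGraph V) (B : Finset V) : Prop :=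
  (H.induce (B : Set V)).Connected ∧ ∀ u ∈ B, ∀ v ∉ B, ¬ H.Adj u v

theorem isComponentSet_congr {H H' : SimpleGraph V} {B : Finset V}
    (h : ∀ u ∈ B, ∀ v, H.Adj u v ↔ H'.Adj u v) : H.IsComponentSet B ↔ H'.IsComponentSet B := by
  have h1 : H.induce (B : Set V) = H'.induce (B : Set V) := by
    ext u v
    exact h u u.2 v
  rw [IsComponentSet, IsComponentSet, h1]
  refine and_congr_right fun _ => forall₂_congr fun u hu => forall₂_congr fun v _ => ?_
  rw [h u hu]

theorem IsComponentSet.reachable {H : SimpleGraph V} {B : Finset V} (h : H.IsComponentSet B)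
    {u v : V} (hu : u ∈ B) (hv : v ∈ B) : H.Reachable u v :=
  (h.1.preconnected ⟨u, hu⟩ ⟨v, hv⟩).map (Embedding.induce (G := H) (B : Set V)).toHom

theorem IsComponentSet.nonempty {H : SimpleGraph V} {B : Finset V} (h : H.IsComponentSet B) :
    B.Nonempty := by
  obtain ⟨v⟩ := h.1.nonempty
  exact ⟨v, v.2⟩

theorem isComponentSet_iff {H : SimpleGraph V} {B : Finset V} :
    H.IsComponentSet B ↔ ∃ c : H.ConnectedComponent, c.supp = B := by
  constructor
  · intro h
    obtain ⟨v, hv⟩ := h.nonempty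
    refine ⟨H.connectedComponentMk v, ?_⟩
    ext u
    rw [ConnectedComponent.mem_supp_iff, ConnectedComponent.eq]
    constructor
    · rintro ⟨p⟩
      by_contra hu
      have : ∀ {a b : V} (p : H.Walk a b), b ∈ B → a ∈ B := by
        intro a b p
        induction p with
        | nil => exact id
        | cons hadj p ih =>
          intro hb
          by_contra ha
          exact h.2 _ (ih hb) _ ha hadj.symm
      exact hu (this p hv)
    · intro hu
      exact h.reachable hu hv
  · rintro ⟨c, hc⟩
    refine ⟨?_, ?_⟩
    · rw [← hc]
      exact c.connected_toSimpleGraph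
    · intro u hu v hv hadj
      apply hv
      rw [← Finset.mem_coe, ← hc] at hu ⊢
      exact c.mem_supp_of_adj_mem_supp hu hadj

/-- Indexing components by finite vertex sets makes the index type independent of `H`, so the sums
over edge subsets and over blocks can be exchanged. -/
theorem sum_connectedComponent [Fintype V] {M : Type*} [AddCommMonoid M] (H : SimpleGraph V)
    [Fintype H.ConnectedComponent] [∀ c : H.ConnectedComponent, DecidablePred (· ∈ c.supp)]
    [DecidablePred H.IsComponentSet] (f : ℕ → M) :
    ∑ c : H.ConnectedComponent, f (Finset.univ.filter (fun v => v ∈ c.supp)).card =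
      ∑ B with H.IsComponentSet B, f B.card := by
  refine Finset.sum_bij (fun c _ => Finset.univ.filter (fun v => v ∈ c.supp)) ?_ ?_ ?_ ?_
  · intro c _
    simp only [Finset.mem_filter, Finset.mem_univ, true_and]
    exact isComponentSet_iff.2 ⟨c, by ext; simp⟩
  · intro c _ c' _ h
    apply ConnectedComponent.supp_injective
    ext v
    simpa using Finset.ext_iff.1 h v
  · intro B hB
    obtain ⟨c, hc⟩ := isComponentSet_iff.1 (Finset.mem_filter.1 hB).2
    refine ⟨c, Finset.mem_univ _, ?_⟩
    ext v
    simp [hc]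
  · intros; rfl

open scoped Classical in
/-- The signed count of the edge subsets having `B` as a component. -/
noncomputable def signedCount (E : Finset (Sym2 V)) (B : Finset V) : ℚ :=
  ∑ S ∈ E.powerset.filter (fun S : Finset (Sym2 V) =>
    (fromEdgeSet (S : Set (Sym2 V))).IsComponentSet B), (-1) ^ S.card

theorem hookPoly_eq_sum [Fintype V] (E : Finset (Sym2 V)) :
    hookPoly E = ∑ B : Finset V, signedCount E B • ((1 + Polynomial.X) ^ (B.card - 1) - 1) := by
  classical
  simp only [hookPoly, signedCount, Finset.sum_smul]
  have h : ∀ S : Finset (Sym2 V),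
      ∑ c : (fromEdgeSet (S : Set (Sym2 V))).ConnectedComponent,
        ((1 + Polynomial.X : Polynomial ℚ) ^
          ((Finset.univ.filter (fun v => v ∈ c.supp)).card - 1) - 1) =
      ∑ B : Finset V, if (fromEdgeSet (S : Set (Sym2 V))).IsComponentSet B then
        ((1 + Polynomial.X : Polynomial ℚ) ^ (B.card - 1) - 1) else 0 := by
    intro S
    rw [← Finset.sum_filter]
    exact sum_connectedComponent _ (fun b => (1 + Polynomial.X : Polynomial ℚ) ^ (b - 1) - 1)
  simp only [Finset.sum_filter]
  rw [Finset.sum_comm]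
  refine Finset.sum_congr rfl fun S _ => ?_
  rw [h, Finset.smul_sum]
  refine Finset.sum_congr rfl fun B _ => ?_
  split_ifs <;> simp

/-- Toggling an edge disjoint from `B` does not affect whether `B` is a component, and it reverses
the sign. -/
theorem signedCount_eq_zero_of_edge (E : Finset (Sym2 V)) (B : Finset V) {x y : V}
    (he : s(x, y) ∈ E) (hx : x ∉ B) (hy : y ∉ B) : signedCount E B = 0 := by
  classical
  rw [signedCount, Finset.sum_filter, ← Finset.insert_erase he,
    Finset.sum_powerset_insert (Finset.notMem_erase _ _), ← Finset.sum_add_distrib]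
  refine Finset.sum_eq_zero fun S hS => ?_
  have hnot : s(x, y) ∉ S := fun h =>
    Finset.notMem_erase _ _ (Finset.mem_powerset.1 hS h)
  have hiff : (fromEdgeSet ((insert s(x, y) S : Finset (Sym2 V)) : Set (Sym2 V))).IsComponentSet B ↔
      (fromEdgeSet (S : Set (Sym2 V))).IsComponentSet B := by
    apply isComponentSet_congr
    intro u hu v
    have : s(u, v) ≠ s(x, y) := by
      intro h
      rcases Sym2.eq_iff.1 h with ⟨rfl, rfl⟩ | ⟨rfl, rfl⟩
      exacts [hx hu, hy hu]
    simp [this]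
  rw [Finset.card_insert_of_notMem hnot, pow_succ]
  simp only [hiff]
  split_ifs <;> ring

/-- The edges with both endpoints in `B`. -/
def edgesWithin [DecidableEq V] (E : Finset (Sym2 V)) (B : Finset V) : Finset (Sym2 V) :=
  E.filter (· ∈ B.sym2)

theorem mk_mem_edgesWithin [DecidableEq V] {E : Finset (Sym2 V)} {B : Finset V} {x y : V} :
    s(x, y) ∈ edgesWithin E B ↔ s(x, y) ∈ E ∧ x ∈ B ∧ y ∈ B := by
  simp [edgesWithin]

theorem edgesWithin_subset [DecidableEq V] (E : Finset (Sym2 V)) (B : Finset V) : edgesWithin E B ⊆ E :=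
  Finset.filter_subset _ _

theorem IsComponentSet.subset_edgesWithin [DecidableEq V] {G : SimpleGraph V} {E S : Finset (Sym2 V)}
    (hE : (E : Set (Sym2 V)) = G.edgeSet)
    {B : Finset V} (h : (fromEdgeSet (S : Set (Sym2 V))).IsComponentSet B) (hS : S ⊆ E)
    (hB : ∀ x y, x ∉ B → y ∉ B → ¬ G.Adj x y) : S ⊆ edgesWithin E B := by
  intro e he
  induction e with | h x y =>
  have hxy : G.Adj x y := by
    have : s(x, y) ∈ (E : Set (Sym2 V)) := hS he
    rwa [hE] at this
  have hadj : (fromEdgeSet (S : Set (Sym2 V))).Adj x y := by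
    rw [fromEdgeSet_adj]; exact ⟨he, hxy.ne⟩
  rw [mk_mem_edgesWithin]
  refine ⟨hS he, ?_⟩
  by_cases hx : x ∈ B
  · refine ⟨hx, ?_⟩
    by_contra hy
    exact h.2 x hx y hy hadj
  · by_cases hy : y ∈ B
    · exact absurd hadj.symm (h.2 y hy x hx)
    · exact absurd hxy (hB x y hx hy)

theorem IsComponentSet.card_le {S : Finset (Sym2 V)}
    {B : Finset V} (h : (fromEdgeSet (S : Set (Sym2 V))).IsComponentSet B) :
    B.card ≤ S.card + 1 := by
  have h1 := h.1.card_vert_le_card_edgeSet_add_one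
  have h2 : Nat.card ((fromEdgeSet (S : Set (Sym2 V))).induce (B : Set V)).edgeSet ≤
      Nat.card (S : Set (Sym2 V)) := by
    refine Nat.card_le_card_of_injective
      (fun e => ⟨e.1.map Subtype.val, ?_⟩) ?_
    · obtain ⟨e, he⟩ := e
      induction e with | h x y =>
      simp at he
      exact he.1
    · intro e e' hee
      apply Subtype.ext
      exact Sym2.map.injective Subtype.val_injective (congrArg Subtype.val hee)
  simp only [Finset.coe_sort_coe, Nat.card_eq_fintype_card, Fintype.card_coe] at h1 h2
  omega

/-- Removing vertices with at most one neighbour keeps a connected graph connected. It is applied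
with `H` equal to the whole graph, or to the graph with a cycle edge deleted. -/
theorem isComponentSet_of_le {H : SimpleGraph V} (hH : H.Connected) {S : Finset (Sym2 V)}
    {B : Finset V} (hB : B.Nonempty) (hdeg : ∀ v ∉ B, (H.neighborSet v).Subsingleton)
    (hSB : ∀ x y, s(x, y) ∈ S → x ∈ B ∧ y ∈ B)
    (hS : ∀ x ∈ B, ∀ y ∈ B, H.Adj x y → s(x, y) ∈ S) :
    (fromEdgeSet (S : Set (Sym2 V))).IsComponentSet B := by
  refine ⟨?_, ?_⟩
  · have h1 : (H.induce (B : Set V)).Preconnected :=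
      hH.preconnected.induce_of_degree_eq_one hdeg
    obtain ⟨b, hb⟩ := hB
    have : Nonempty (B : Set V) := ⟨⟨b, hb⟩⟩
    refine (Connected.mk h1).mono ?_
    rintro ⟨x, hx⟩ ⟨y, hy⟩ hxy
    have hxy : H.Adj x y := hxy
    simp only [comap_adj, Function.Embedding.subtype_apply, fromEdgeSet_adj, Finset.mem_coe]
    exact ⟨hS x hx y hy hxy, hxy.ne⟩
  · intro u _ v hv hadj
    rw [fromEdgeSet_adj] at hadj
    exact hv (hSB u v hadj.1).2

/-- As the complement of `B` is independent, every edge not inside `B` has exactly one endpoint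
outside and is counted once by that endpoint's degree. -/
theorem card_edgesWithin_add [Fintype V] [DecidableEq V] {G : SimpleGraph V} [DecidableRel G.Adj]
    {E : Finset (Sym2 V)} (hE : (E : Set (Sym2 V)) = G.edgeSet) {B U : Finset V}
    (hU : ∀ v, v ∈ U ↔ v ∉ B)
    (hB : ∀ x y, x ∉ B → y ∉ B → ¬ G.Adj x y) :
    (edgesWithin E B).card + ∑ u ∈ U, G.degree u = E.card := by
  have h1 : E \ edgesWithin E B = U.biUnion fun u => G.incidenceFinset u := by
    ext e
    induction e with | h x y =>
    have hxy : s(x, y) ∈ E ↔ G.Adj x y := by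
      rw [← Finset.mem_coe, hE, mem_edgeSet]
    simp only [Finset.mem_sdiff, mk_mem_edgesWithin, Finset.mem_biUnion, mem_incidenceFinset,
      mk'_mem_incidenceSet_iff, hxy, hU]
    constructor
    · rintro ⟨h, h'⟩
      by_cases hx : x ∈ B
      · exact ⟨y, fun hy => h' ⟨h, hx, hy⟩, h, Or.inr rfl⟩
      · exact ⟨x, hx, h, Or.inl rfl⟩
    · rintro ⟨u, hu, h, rfl | rfl⟩
      · exact ⟨h, fun h' => hu h'.2.1⟩
      · exact ⟨h, fun h' => hu h'.2.2⟩
  rw [← Finset.card_sdiff_add_card_eq_card (edgesWithin_subset E B), h1, Finset.card_biUnion,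
    add_comm]
  · simp
  · intro u hu v hv huv
    rw [Function.onFun, Finset.disjoint_left]
    intro e he he'
    rw [mem_incidenceFinset] at he he'
    exact hB u v ((hU u).1 hu) ((hU v).1 hv) (G.adj_of_mem_incidenceSet huv he he')

end SimpleGraph

/-! ### Structure of connected unicyclic graphs. -/

namespace SimpleGraph

variable {V : Type*} {G : SimpleGraph V} {C : G.Subgraph}

theorem IsUniqueCycle.isBridge_iff (hC : IsUniqueCycle C) {e : Sym2 V} (he : e ∈ G.edgeSet) :
    G.IsBridge e ↔ e ∉ C.edgeSet := by
  rw [isBridge_iff_forall_cycle_notMem he]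
  constructor
  · intro h
    obtain ⟨u, p, hp, hpC⟩ := hC.1
    rw [← hpC, Walk.mem_edges_toSubgraph]
    exact h p hp
  · intro h u p hp hep
    rw [← Walk.mem_edges_toSubgraph, hC.2 _ ⟨u, p, hp, rfl⟩] at hep
    exact h hep

theorem IsCycleSubgraph.ncard_edgeSet (hC : IsCycleSubgraph C) :
    C.edgeSet.ncard = C.verts.ncard := by
  classical
  obtain ⟨u, p, hp, rfl⟩ := hC
  have h1 : p.toSubgraph.edgeSet = (p.edges.toFinset : Set (Sym2 V)) := by
    ext e
    simp
  have h2 : p.toSubgraph.verts = (p.support.tail.toFinset : Set V) := by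
    ext v
    rw [Walk.verts_toSubgraph]
    simp only [Set.mem_ofPred_eq, List.coe_toFinset]
    constructor
    · intro h
      rw [Walk.mem_support_iff] at h
      rcases h with rfl | h
      · exact Walk.end_mem_tail_support hp.not_nil
      · exact h
    · exact List.mem_of_mem_tail
  rw [h1, h2, Set.ncard_coe_finset, Set.ncard_coe_finset, List.toFinset_card_of_nodup hp.edges_nodup,
    List.toFinset_card_of_nodup hp.support_nodup]
  simp

theorem IsCycleSubgraph.three_le_ncard_edgeSet (hC : IsCycleSubgraph C) :
    3 ≤ C.edgeSet.ncard := by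
  classical
  obtain ⟨u, p, hp, rfl⟩ := hC
  have h1 : p.toSubgraph.edgeSet = (p.edges.toFinset : Set (Sym2 V)) := by
    ext e
    simp
  rw [h1, Set.ncard_coe_finset, List.toFinset_card_of_nodup hp.edges_nodup, Walk.length_edges]
  exact hp.three_le_length

theorem IsCycleSubgraph.ncard_neighborSet (hC : IsCycleSubgraph C) {v : V} (hv : v ∈ C.verts) :
    (C.neighborSet v).ncard = 2 := by
  obtain ⟨u, p, hp, rfl⟩ := hC
  rw [Walk.mem_verts_toSubgraph] at hv
  exact hp.ncard_neighborSet_toSubgraph_eq_two hv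

theorem IsUniqueCycle.connected_deleteEdges (hconn : G.Connected) (hC : IsUniqueCycle C)
    {x y : V} (he : C.Adj x y) : (G.deleteEdges {s(x, y)}).Connected := by
  apply hconn.connected_delete_edge_of_not_isBridge
  rw [hC.isBridge_iff (C.adj_sub he)]
  exact fun h => h he

theorem IsUniqueCycle.exists_adj (hC : IsUniqueCycle C) : ∃ x y, C.Adj x y := by
  have h := hC.1.three_le_ncard_edgeSet
  have : C.edgeSet.Nonempty := by
    rw [Set.nonempty_iff_ne_empty]
    rintro h0
    rw [h0] at h
    simp at h
  obtain ⟨e, he⟩ := this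
  induction e with | h x y => exact ⟨x, y, he⟩

/-- Deleting one cycle edge leaves a tree: the graph stays connected, and any remaining cycle would
equal `C` and so use the deleted edge. -/
theorem IsUniqueCycle.card_edges [Fintype V] (hconn : G.Connected) (hC : IsUniqueCycle C)
    {E : Finset (Sym2 V)} (hE : (E : Set (Sym2 V)) = G.edgeSet) : E.card = Fintype.card V := by
  classical
  obtain ⟨x, y, hxy⟩ := hC.exists_adj
  have hT : (G.deleteEdges {s(x, y)}).IsTree := by
    refine ⟨hC.connected_deleteEdges hconn hxy, ?_⟩
    intro v q hq
    have hle : G.deleteEdges {s(x, y)} ≤ G := deleteEdges_le _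
    have h1 := hC.2 _ ⟨v, q.mapLe hle, hq.mapLe hle, rfl⟩
    have h2 : s(x, y) ∈ (q.mapLe hle).toSubgraph.edgeSet := by rw [h1]; exact hxy
    rw [Walk.mem_edges_toSubgraph, Walk.edges_mapLe_eq_edges] at h2
    have := q.edges_subset_edgeSet h2
    simp at this
  have h1 := hT.card_edgeFinset
  have h2 : (G.deleteEdges {s(x, y)}).edgeFinset = E.erase s(x, y) := by
    rw [← Finset.coe_inj]
    simp [hE, edgeSet_deleteEdges]
  have h3 : s(x, y) ∈ E := by
    rw [← Finset.mem_coe, hE]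
    exact C.adj_sub hxy
  rw [h2, Finset.card_erase_of_mem h3] at h1
  have : 0 < E.card := Finset.card_pos.2 ⟨_, h3⟩
  omega

section degree

variable [Fintype V] [DecidableRel G.Adj]

theorem ncard_neighborSet_eq_degree (v : V) : (G.neighborSet v).ncard = G.degree v := by
  rw [← card_neighborFinset_eq_degree, ← Set.ncard_coe_finset, coe_neighborFinset]

theorem IsUniqueCycle.two_le_degree (hC : IsUniqueCycle C) {v : V} (hv : v ∈ C.verts) :
    2 ≤ G.degree v := by
  rw [← hC.1.ncard_neighborSet hv, ← ncard_neighborSet_eq_degree]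
  exact Set.ncard_le_ncard (C.neighborSet_subset v) (Set.toFinite _)

theorem IsUniqueCycle.one_le_degree (hconn : G.Connected) (hC : IsUniqueCycle C) (v : V) :
    1 ≤ G.degree v := by
  obtain ⟨x, y, hxy⟩ := hC.exists_adj
  have : Nontrivial V := ⟨x, y, hxy.ne⟩
  exact hconn.preconnected.degree_pos_of_nontrivial v

theorem IsUniqueCycle.neighborSet_eq (hC : IsUniqueCycle C) {v : V} (hv : v ∈ C.verts)
    (hd : G.degree v = 2) : C.neighborSet v = G.neighborSet v := by
  refine Set.eq_of_subset_of_ncard_le (C.neighborSet_subset v) ?_ (Set.toFinite _)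
  rw [hC.1.ncard_neighborSet hv, ncard_neighborSet_eq_degree, hd]

/-- The cycle uses exactly two edges at `v`, so a nontrivial tree hangs there exactly when `v` has a
further edge. -/
theorem IsUniqueCycle.nontrivial_rootedTreeVerts_iff (hC : IsUniqueCycle C) {v : V}
    (hv : v ∈ C.verts) : (rootedTreeVerts C v).Nontrivial ↔ G.degree v ≠ 2 := by
  constructor
  · rintro h hd
    obtain ⟨w, hw, hne⟩ := h.exists_ne v
    obtain ⟨p⟩ : (G.deleteEdges C.edgeSet).Reachable v w := hw
    cases p with
    | nil => exact hne rfl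
    | cons hadj p =>
      rename_i x
      rw [deleteEdges_adj] at hadj
      have : x ∈ C.neighborSet v := by
        rw [hC.neighborSet_eq hv hd]
        exact hadj.1
      exact hadj.2 this
  · intro hd
    have : ∃ w, G.Adj v w ∧ ¬ C.Adj v w := by
      by_contra hcon
      push Not at hcon
      apply hd
      rw [← ncard_neighborSet_eq_degree, ← hC.1.ncard_neighborSet hv]
      congr 1
      ext w
      exact ⟨fun h => hcon w h, fun h => C.adj_sub h⟩
    obtain ⟨w, hw, hwC⟩ := this
    refine ⟨v, Reachable.refl _, w, Adj.reachable ?_, hw.ne⟩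
    rw [deleteEdges_adj]
    exact ⟨hw, hwC⟩

theorem IsUniqueCycle.card_degree_two_add (hC : IsUniqueCycle C) {D : Finset V}
    (hD : ∀ v, v ∈ D ↔ v ∈ C.verts ∧ G.degree v = 2) :
    D.card + numNontrivialRootedTrees C = C.verts.ncard := by
  have h1 : {v ∈ C.verts | (rootedTreeVerts C v).Nontrivial} = C.verts \ (D : Set V) := by
    ext v
    simp only [Set.mem_ofPred_eq, Set.mem_sdiff, Finset.mem_coe, hD]
    constructor
    · rintro ⟨h, h'⟩
      exact ⟨h, fun h2 => (hC.nontrivial_rootedTreeVerts_iff h).1 h' h2.2⟩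
    · rintro ⟨h, h'⟩
      exact ⟨h, (hC.nontrivial_rootedTreeVerts_iff h).2 fun h2 => h' ⟨h, h2⟩⟩
  rw [numNontrivialRootedTrees, h1, ← Set.ncard_coe_finset D, add_comm]
  exact Set.ncard_sdiff_add_ncard_of_subset (fun v hv => ((hD v).1 hv).1) (Set.toFinite _)

/-- Two adjacent leaves would form the whole connected graph, leaving no room for a cycle. -/
theorem IsUniqueCycle.not_adj_of_degree_one (hconn : G.Connected) (hC : IsUniqueCycle C) {u v : V}
    (hu : G.degree u = 1) (hv : G.degree v = 1) : ¬ G.Adj u v := by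
  intro huv
  obtain ⟨x, y, hxy⟩ := hC.exists_adj
  have hu' : ∀ w, G.Adj u w → w = v := by
    obtain ⟨a, -, ha⟩ := degree_eq_one_iff_existsUnique_adj.1 hu
    intro w hw
    rw [ha w hw, ha v huv]
  have hv' : ∀ w, G.Adj v w → w = u := by
    obtain ⟨a, -, ha⟩ := degree_eq_one_iff_existsUnique_adj.1 hv
    intro w hw
    rw [ha w hw, ha u huv.symm]
  have key : ∀ {a b : V} (p : G.Walk a b), (a = u ∨ a = v) → (b = u ∨ b = v) := by
    intro a b p
    induction p with
    | nil => exact id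
    | cons hadj p ih =>
      rintro (rfl | rfl)
      · exact ih (Or.inr (hu' _ hadj))
      · exact ih (Or.inl (hv' _ hadj))
  obtain ⟨p⟩ := hconn.preconnected u x
  have hx := hC.two_le_degree (C.edge_vert hxy)
  rcases key p (Or.inl rfl) with rfl | rfl <;> omega

/-- If every vertex of the cycle has degree two, the cycle is everything. -/
theorem IsUniqueCycle.verts_eq_univ (hconn : G.Connected) (hC : IsUniqueCycle C)
    (h : ∀ v ∈ C.verts, G.degree v = 2) : C.verts = Set.univ := by
  obtain ⟨x, y, hxy⟩ := hC.exists_adj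
  have key : ∀ {a b : V} (p : G.Walk a b), a ∈ C.verts → b ∈ C.verts := by
    intro a b p
    induction p with
    | nil => exact id
    | cons hadj p ih =>
      rename_i a w b
      intro ha
      apply ih
      have : w ∈ C.neighborSet a := by
        rw [hC.neighborSet_eq ha (h a ha)]
        exact hadj
      exact C.edge_vert this.symm
  ext v
  obtain ⟨p⟩ := hconn.preconnected x v
  simpa using key p (C.edge_vert hxy)

end degree

end SimpleGraph

/-! ### Evaluation of the signed counts. -/

namespace SimpleGraph

theorem subsingleton_neighborSet_of_degree_eq_one {V : Type*} [Fintype V] {G : SimpleGraph V}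
    [DecidableRel G.Adj] {v : V} (hv : G.degree v = 1) :
    (G.neighborSet v).Subsingleton := by
  obtain ⟨a, -, ha⟩ := degree_eq_one_iff_existsUnique_adj.1 hv
  intro x hx y hy
  rw [ha x hx, ha y hy]

variable {V : Type*} [Fintype V] [DecidableEq V] {G : SimpleGraph V} [DecidableRel G.Adj]
  {C : G.Subgraph} {E : Finset (Sym2 V)}

/-- Off the leaves in `T` there remain $n-|T|$ vertices and as many edges, so a connected spanning
edge set omits at most one edge, and an omitted edge cannot be a bridge. The full set and the $c$
sets missing one cycle edge have opposite signs. -/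
theorem IsUniqueCycle.signedCount_compl_of_leaves (hconn : G.Connected) (hC : IsUniqueCycle C)
    (hE : (E : Set (Sym2 V)) = G.edgeSet) {T : Finset V} (hT : ∀ v ∈ T, G.degree v = 1) :
    signedCount E Tᶜ = (-1) ^ (Fintype.card V - T.card) * (1 - (C.verts.ncard : ℚ)) := by
  have hmem : ∀ {x y : V}, s(x, y) ∈ E ↔ G.Adj x y := by
    intro x y
    rw [← Finset.mem_coe, hE, mem_edgeSet]
  have hind : ∀ x y, x ∉ Tᶜ → y ∉ Tᶜ → ¬ G.Adj x y := by
    intro x y hx hy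
    rw [Finset.mem_compl, not_not] at hx hy
    exact hC.not_adj_of_degree_one hconn (hT x hx) (hT y hy)
  have hcard : (edgesWithin E Tᶜ).card = Fintype.card V - T.card := by
    have h1 := card_edgesWithin_add hE (B := Tᶜ) (U := T) (by simp) hind
    rw [Finset.sum_congr rfl hT, hC.card_edges hconn hE] at h1
    simp only [Finset.sum_const, smul_eq_mul, mul_one] at h1
    omega
  have hBcard : Tᶜ.card = Fintype.card V - T.card := Finset.card_compl T
  have hverts : ∀ v ∈ C.verts, v ∈ Tᶜ := by
    intro v hv
    rw [Finset.mem_compl]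
    intro h
    have h1 := hC.two_le_degree hv
    have h2 := hT v h
    omega
  let CE : Finset (Sym2 V) := (Set.toFinite C.edgeSet).toFinset
  have hCE : ∀ {x y : V}, s(x, y) ∈ CE ↔ C.Adj x y := by
    intro x y
    simp [CE]
  have hCEsub : CE ⊆ edgesWithin E Tᶜ := by
    intro e he
    induction e with | h x y =>
    rw [hCE] at he
    rw [mk_mem_edgesWithin]
    exact ⟨hmem.2 (C.adj_sub he), hverts x (C.edge_vert he), hverts y (C.edge_vert he.symm)⟩
  have hCEcard : CE.card = C.verts.ncard := by
    rw [← hC.1.ncard_edgeSet, ← Set.ncard_coe_finset]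
    simp [CE]
  obtain ⟨a, b, hab⟩ := hC.exists_adj
  have hBne : Tᶜ.Nonempty := ⟨a, hverts a (C.edge_vert hab)⟩
  have hpos : 0 < Fintype.card V - T.card := by
    rw [← hBcard]
    exact Finset.card_pos.2 hBne
  have hsub : ∀ v ∉ Tᶜ, (G.neighborSet v).Subsingleton := by
    intro v hv
    rw [Finset.mem_compl, not_not] at hv
    exact subsingleton_neighborSet_of_degree_eq_one (hT v hv)
  classical
  have hfilter : E.powerset.filter (fun S : Finset (Sym2 V) =>
      (fromEdgeSet (S : Set (Sym2 V))).IsComponentSet Tᶜ) =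
      insert (edgesWithin E Tᶜ) (CE.image (edgesWithin E Tᶜ).erase) := by
    ext S
    rw [Finset.mem_filter, Finset.mem_powerset, Finset.mem_insert, Finset.mem_image]
    constructor
    · rintro ⟨hSE, hS⟩
      have hSsub := hS.subset_edgesWithin hE hSE hind
      by_cases heq : S = edgesWithin E Tᶜ
      · exact Or.inl heq
      right
      have hlt := Finset.card_lt_card (Finset.ssubset_iff_subset_ne.2 ⟨hSsub, heq⟩)
      obtain ⟨e, he, heS⟩ := Finset.exists_of_ssubset (Finset.ssubset_iff_subset_ne.2 ⟨hSsub, heq⟩)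
      have hSe : S = (edgesWithin E Tᶜ).erase e := by
        refine Finset.eq_of_subset_of_card_le ?_ ?_
        · intro f hf
          exact Finset.mem_erase.2 ⟨fun h => heS (h ▸ hf), hSsub hf⟩
        · rw [Finset.card_erase_of_mem he]
          have := hS.card_le
          omega
      refine ⟨e, ?_, hSe.symm⟩
      induction e with | h x y =>
      rw [mk_mem_edgesWithin] at he
      rw [hCE]
      by_contra hxy
      have hbr := (hC.isBridge_iff (e := s(x, y)) (hmem.1 he.1)).2 hxy
      rw [SimpleGraph.isBridge_iff] at hbr
      apply hbr
      refine (hS.reachable he.2.1 he.2.2).mono ?_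
      intro c d hcd
      rw [fromEdgeSet_adj] at hcd
      rw [deleteEdges_adj]
      exact ⟨hmem.1 (hSE hcd.1), fun h => heS (h ▸ hcd.1)⟩
    · rintro (rfl | ⟨e, he, rfl⟩)
      · refine ⟨edgesWithin_subset _ _, isComponentSet_of_le hconn hBne hsub ?_ ?_⟩
        · intro x y h
          exact (mk_mem_edgesWithin.1 h).2
        · intro x hx y hy h
          exact mk_mem_edgesWithin.2 ⟨hmem.2 h, hx, hy⟩
      · refine ⟨(Finset.erase_subset _ _).trans (edgesWithin_subset _ _), ?_⟩
        induction e with | h x y =>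
        refine isComponentSet_of_le (hC.connected_deleteEdges hconn (hCE.1 he)) hBne ?_ ?_ ?_
        · intro v hv
          exact (hsub v hv).anti fun w hw => (deleteEdges_le {s(x, y)}) hw
        · intro c d h
          exact (mk_mem_edgesWithin.1 (Finset.mem_of_mem_erase h)).2
        · intro c hc d hd h
          rw [deleteEdges_adj] at h
          exact Finset.mem_erase.2 ⟨h.2, mk_mem_edgesWithin.2 ⟨hmem.2 h.1, hc, hd⟩⟩
  rw [signedCount]
  have hsum : ∑ S ∈ insert (edgesWithin E Tᶜ) (CE.image (edgesWithin E Tᶜ).erase),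
      (-1 : ℚ) ^ S.card = (-1) ^ (Fintype.card V - T.card) * (1 - (C.verts.ncard : ℚ)) := by
    rw [Finset.sum_insert, Finset.sum_image]
    · rw [hcard, Finset.sum_congr rfl (g := fun _ => (-1 : ℚ) ^ (Fintype.card V - T.card - 1))]
      · rw [Finset.sum_const, hCEcard, nsmul_eq_mul]
        obtain ⟨m, hm⟩ := Nat.exists_eq_succ_of_ne_zero hpos.ne'
        rw [hm, Nat.succ_sub_one, pow_succ]
        ring
      · intro e he
        rw [Finset.card_erase_of_mem (hCEsub he), hcard]
    · exact (Finset.erase_injOn _).mono (fun e he => hCEsub he)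
    · rw [Finset.mem_image]
      rintro ⟨e, he, h⟩
      exact Finset.erase_ne_self.2 (hCEsub he) h
  rw [← hsum]
  refine Finset.sum_congr ?_ fun _ _ => rfl
  rw [← hfilter]

/-- Removing a cycle vertex of degree 2 as well leaves $n-|T|-1$ vertices and one edge fewer, so
connectedness forces every remaining edge to be present. -/
theorem IsUniqueCycle.signedCount_compl_of_insert (hconn : G.Connected) (hC : IsUniqueCycle C)
    (hE : (E : Set (Sym2 V)) = G.edgeSet) {T : Finset V} (hT : ∀ v ∈ T, G.degree v = 1)
    {v : V} (hv : v ∈ C.verts) (hd : G.degree v = 2) :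
    signedCount E (insert v T)ᶜ = (-1) ^ (Fintype.card V - T.card - 2) := by
  have hmem : ∀ {x y : V}, s(x, y) ∈ E ↔ G.Adj x y := by
    intro x y
    rw [← Finset.mem_coe, hE, mem_edgeSet]
  have hvT : v ∉ T := fun h => by
    have := hT v h
    omega
  have hadjC : ∀ w, G.Adj v w → C.Adj v w := by
    intro w hw
    have : w ∈ C.neighborSet v := by
      rw [hC.neighborSet_eq hv hd]
      exact hw
    exact this
  have hvadj : ∀ w, G.Adj v w → w ∉ insert v T := by
    intro w hw h
    have h1 := hC.two_le_degree (C.edge_vert (hadjC w hw).symm)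
    rcases Finset.mem_insert.1 h with rfl | h
    · exact hw.ne rfl
    · have := hT w h
      omega
  have hind : ∀ x y, x ∉ (insert v T)ᶜ → y ∉ (insert v T)ᶜ → ¬ G.Adj x y := by
    intro x y hx hy hxy
    rw [Finset.mem_compl, not_not] at hx hy
    rcases Finset.mem_insert.1 hx with rfl | hx'
    · exact hvadj y hxy hy
    · rcases Finset.mem_insert.1 hy with rfl | hy'
      · exact hvadj x hxy.symm hx
      · exact hC.not_adj_of_degree_one hconn (hT x hx') (hT y hy') hxy
  have hcard : (edgesWithin E (insert v T)ᶜ).card = Fintype.card V - T.card - 2 := by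
    have h1 := card_edgesWithin_add hE (B := (insert v T)ᶜ) (U := insert v T)
      (fun w => by rw [Finset.mem_compl, not_not]) hind
    rw [Finset.sum_insert hvT, Finset.sum_congr rfl hT, hC.card_edges hconn hE, hd] at h1
    simp only [Finset.sum_const, smul_eq_mul, mul_one] at h1
    omega
  have hBcard : (insert v T)ᶜ.card = Fintype.card V - T.card - 1 := by
    rw [Finset.card_compl, Finset.card_insert_of_notMem hvT]
    omega
  obtain ⟨x, hx⟩ : ∃ x, G.Adj v x := by
    have : 0 < G.degree v := by omega
    rwa [degree_pos_iff_exists_adj] at this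
  have hBne : (insert v T)ᶜ.Nonempty := ⟨x, Finset.mem_compl.2 (hvadj x hx)⟩
  classical
  have hfilter : E.powerset.filter (fun S : Finset (Sym2 V) =>
      (fromEdgeSet (S : Set (Sym2 V))).IsComponentSet (insert v T)ᶜ) =
      {edgesWithin E (insert v T)ᶜ} := by
    ext S
    rw [Finset.mem_filter, Finset.mem_powerset, Finset.mem_singleton]
    constructor
    · rintro ⟨hSE, hS⟩
      refine Finset.eq_of_subset_of_card_le (hS.subset_edgesWithin hE hSE hind) ?_
      have := hS.card_le
      omega
    · rintro rfl
      refine ⟨edgesWithin_subset _ _,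
        isComponentSet_of_le (hC.connected_deleteEdges hconn (hadjC x hx)) hBne ?_ ?_ ?_⟩
      · intro u hu
        rw [Finset.mem_compl, not_not] at hu
        rcases Finset.mem_insert.1 hu with rfl | hu
        -- Once one of its two cycle edges is deleted, the cycle vertex has a single neighbour and
        -- can be removed like a leaf.
        · have h2 : (G.neighborFinset u).card = 2 := hd
          have h3 : ((G.neighborFinset u).erase x).card = 1 := by
            rw [Finset.card_erase_of_mem (by simpa using hx), h2]
          obtain ⟨y, hy⟩ := Finset.card_eq_one.1 h3
          have h4 : ∀ w, (G.deleteEdges {s(u, x)}).Adj u w → w = y := by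
            intro w hw
            rw [deleteEdges_adj] at hw
            rw [← Finset.mem_singleton, ← hy, Finset.mem_erase, mem_neighborFinset]
            exact ⟨fun h => hw.2 (by rw [h]; rfl), hw.1⟩
          intro a ha b hb
          rw [h4 a ha, h4 b hb]
        · exact (subsingleton_neighborSet_of_degree_eq_one (hT u hu)).anti
            fun w hw => (deleteEdges_le {s(v, x)}) hw
      · intro c d h
        exact (mk_mem_edgesWithin.1 h).2
      · intro c hc d hd h
        rw [deleteEdges_adj] at h
        exact mk_mem_edgesWithin.2 ⟨hmem.2 h.1, hc, hd⟩
  rw [signedCount, ← hcard]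
  have hsum : ∑ S ∈ {edgesWithin E (insert v T)ᶜ}, (-1 : ℚ) ^ S.card =
    (-1) ^ (edgesWithin E (insert v T)ᶜ).card := Finset.sum_singleton _ _
  rw [← hsum]
  refine Finset.sum_congr ?_ fun _ _ => rfl
  rw [← hfilter]

/-- Independence of `U` leaves $n-\sum_{u\in U}\deg u$ edges inside the complement, and
connectedness needs at least $n-|U|-1$. Hence $\sum_{u\in U}(\deg u-1)\le1$, which allows at most
one vertex of degree 2. -/
theorem IsUniqueCycle.of_signedCount_compl_ne_zero (hconn : G.Connected) (hC : IsUniqueCycle C)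
    (hE : (E : Set (Sym2 V)) = G.edgeSet) {U : Finset V} (hU : signedCount E Uᶜ ≠ 0) :
    (∀ u ∈ U, G.degree u = 1) ∨
      ∃ v ∈ U, v ∈ C.verts ∧ G.degree v = 2 ∧ ∀ u ∈ U.erase v, G.degree u = 1 := by
  have hmem : ∀ {x y : V}, s(x, y) ∈ E ↔ G.Adj x y := by
    intro x y
    rw [← Finset.mem_coe, hE, mem_edgeSet]
  have hind : ∀ x y, x ∉ Uᶜ → y ∉ Uᶜ → ¬ G.Adj x y := by
    intro x y hx hy hxy
    exact hU (signedCount_eq_zero_of_edge E Uᶜ (hmem.2 hxy) hx hy)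
  obtain ⟨S, hSE, hS⟩ : ∃ S : Finset (Sym2 V), S ⊆ E ∧
      (fromEdgeSet (S : Set (Sym2 V))).IsComponentSet Uᶜ := by
    by_contra hcon
    push Not at hcon
    apply hU
    classical
    rw [signedCount]
    refine Finset.sum_eq_zero fun S hS => ?_
    rw [Finset.mem_filter, Finset.mem_powerset] at hS
    exact absurd hS.2 (hcon S hS.1)
  have hSsub := hS.subset_edgesWithin hE hSE hind
  have h1 := card_edgesWithin_add hE (B := Uᶜ) (U := U) (by simp) hind
  rw [hC.card_edges hconn hE] at h1
  have h2 := hS.card_le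
  have h3 := Finset.card_le_card hSsub
  have h4 := Finset.card_add_card_compl U
  have hdeg := fun u => hC.one_le_degree hconn u
  rw [or_iff_not_imp_left]
  intro hne
  push Not at hne
  obtain ⟨v, hvU, hv⟩ := hne
  have hsplit := Finset.add_sum_erase U (fun u => G.degree u) hvU
  have hcardU := Finset.card_erase_add_one hvU
  have hge : (U.erase v).card ≤ ∑ u ∈ U.erase v, G.degree u := by
    rw [Finset.card_eq_sum_ones]
    exact Finset.sum_le_sum fun u _ => hdeg u
  have hv1 := hdeg v
  have hv2 : G.degree v = 2 := by
    omega
  refine ⟨v, hvU, ?_, hv2, ?_⟩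
  -- Off the cycle, `vx` would be a bridge; but the other neighbour `y` is joined to `x` by edges of
  -- `S`, none of which meets `v`.
  · by_contra hvC
    have hcard2 : (G.neighborFinset v).card = 2 := hv2
    obtain ⟨x, y, hxy, hN⟩ := Finset.card_eq_two.1 hcard2
    have hx : G.Adj v x := by
      rw [← mem_neighborFinset, hN]; simp
    have hy : G.Adj v y := by
      rw [← mem_neighborFinset, hN]; simp
    have hout : ∀ w, G.Adj v w → w ∈ Uᶜ := by
      intro w hw
      by_contra h
      exact hind v w (by simpa using hvU) h hw
    have hbr := (hC.isBridge_iff (e := s(v, x)) hx).2 (fun h => hvC (C.edge_vert h))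
    rw [SimpleGraph.isBridge_iff] at hbr
    apply hbr
    have hvy : (G.deleteEdges {s(v, x)}).Adj v y := by
      rw [deleteEdges_adj]
      refine ⟨hy, fun h => ?_⟩
      rcases Sym2.eq_iff.1 h with ⟨-, h⟩ | ⟨h, -⟩
      · exact hxy h.symm
      · exact hx.ne h
    refine hvy.reachable.trans ((hS.reachable (hout y hy) (hout x hx)).mono ?_)
    intro c d hcd
    rw [fromEdgeSet_adj] at hcd
    rw [deleteEdges_adj]
    refine ⟨hmem.1 (hSE hcd.1), fun h => ?_⟩
    have hin : s(c, d) = s(v, x) := h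
    have := hSsub hcd.1
    rw [hin, mk_mem_edgesWithin, Finset.mem_compl] at this
    exact this.2.1 hvU
  · intro u hu
    by_contra hu1
    have hlt : (U.erase v).card < ∑ u ∈ U.erase v, G.degree u := by
      rw [Finset.card_eq_sum_ones]
      refine Finset.sum_lt_sum (fun u _ => hdeg u) ⟨u, hu, ?_⟩
      have := hdeg u
      omega
    omega

end SimpleGraph

/-! ### Closed form of the hook polynomial. -/

namespace SimpleGraph

-- This is the binomial theorem over subsets, with $1-(1+X)=-X$ and $1-1=0$; the term $0^{|L|}$
-- matters only when there are no leaves.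
open Polynomial in
theorem sum_powerset_signed_pow {ι : Type*} (L : Finset ι) (m : ℕ) :
    ∑ T ∈ L.powerset, (-1 : ℚ) ^ (m + (L.card - T.card)) •
      ((1 + X : ℚ[X]) ^ (m + (L.card - T.card)) - 1) =
    (-(1 + X)) ^ m * (-X) ^ L.card - (-1) ^ m * 0 ^ L.card := by
  have h1 := Finset.sum_pow_mul_eq_add_pow (1 : ℚ[X]) (-(1 + X)) L
  have h2 := Finset.sum_pow_mul_eq_add_pow (1 : ℚ[X]) (-1) L
  rw [show (1 : ℚ[X]) + -(1 + X) = -X by ring] at h1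
  rw [show (1 : ℚ[X]) + -1 = 0 by ring] at h2
  rw [← h1, ← h2, Finset.mul_sum, Finset.mul_sum, ← Finset.sum_sub_distrib]
  refine Finset.sum_congr rfl fun T _ => ?_
  rw [smul_eq_C_mul, one_pow, one_mul, one_mul, ← pow_add, ← pow_add, neg_pow (1 + X : ℚ[X])]
  simp only [map_pow, map_neg, map_one]
  ring

variable {V : Type*} [Fintype V] {G : SimpleGraph V} [DecidableRel G.Adj]
  {C : G.Subgraph} {E : Finset (Sym2 V)}

theorem IsUniqueCycle.card_leaves_add_le (hC : IsUniqueCycle C) {L : Finset V}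
    (hL : ∀ v, v ∈ L ↔ G.degree v = 1) : L.card + C.verts.ncard ≤ Fintype.card V := by
  rw [← Set.ncard_coe_finset L, ← Set.ncard_union_eq, ← Nat.card_eq_fintype_card, ← Set.ncard_univ]
  · exact Set.ncard_le_ncard (Set.subset_univ _) (Set.toFinite _)
  · rw [Set.disjoint_left]
    intro v hv hvC
    have h1 := (hL v).1 hv
    have h2 := hC.two_le_degree hvC
    omega

/-- If no tree hangs on the cycle, the cycle is spanning with all degrees 2. Conversely, without
leaves all degrees are at least 2, and their sum $2n$ forces equality. -/
theorem IsUniqueCycle.leaves_eq_empty_iff (hconn : G.Connected) (hC : IsUniqueCycle C)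
    {L : Finset V} (hL : ∀ v, v ∈ L ↔ G.degree v = 1) :
    numNontrivialRootedTrees C = 0 ↔ L = ∅ := by
  have hr : numNontrivialRootedTrees C = 0 ↔ ∀ v ∈ C.verts, G.degree v = 2 := by
    rw [numNontrivialRootedTrees, Set.ncard_eq_zero (Set.toFinite _), Set.eq_empty_iff_forall_notMem]
    refine forall_congr' fun v => ?_
    rw [Set.mem_ofPred_eq, not_and]
    refine forall_congr' fun hv => ?_
    rw [hC.nontrivial_rootedTreeVerts_iff hv, not_not]
  rw [hr]
  constructor
  · intro h
    have h1 := hC.verts_eq_univ hconn h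
    rw [Finset.eq_empty_iff_forall_notMem]
    intro v hv
    have h2 := h v (h1 ▸ Set.mem_univ v)
    have h3 := (hL v).1 hv
    omega
  · intro h v _
    have h2 : ∀ u, 2 ≤ G.degree u := by
      intro u
      have h3 := hC.one_le_degree hconn u
      have h4 : u ∉ L := by rw [h]; simp
      rw [hL] at h4
      omega
    by_contra hv
    have h5 : ∑ _u : V, 2 < ∑ u, G.degree u := by
      refine Finset.sum_lt_sum (fun u _ => h2 u) ⟨v, Finset.mem_univ v, ?_⟩
      have := h2 v
      omega
    rw [sum_degrees_eq_twice_card_edges, hC.card_edges hconn (coe_edgeFinset G)] at h5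
    simp at h5
    omega

variable [DecidableEq V]

theorem IsUniqueCycle.sum_signedCount {M : Type*} [AddCommGroup M] [Module ℚ M]
    (hconn : G.Connected) (hC : IsUniqueCycle C)
    (hE : (E : Set (Sym2 V)) = G.edgeSet) {L D : Finset V}
    (hL : ∀ v, v ∈ L ↔ G.degree v = 1) (hD : ∀ v, v ∈ D ↔ v ∈ C.verts ∧ G.degree v = 2)
    (f : ℕ → M) :
    ∑ B : Finset V, signedCount E B • f B.card =
      (∑ T ∈ L.powerset, ((-1 : ℚ) ^ (Fintype.card V - T.card) * (1 - (C.verts.ncard : ℚ))) •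
        f (Fintype.card V - T.card)) +
      (D.card : ℚ) • ∑ T ∈ L.powerset, (-1 : ℚ) ^ (Fintype.card V - T.card - 2) •
        f (Fintype.card V - T.card - 1) := by
  have hvL : ∀ {T : Finset V}, T ∈ L.powerset → ∀ v ∈ T, G.degree v = 1 := by
    intro T hT v hv
    exact (hL v).1 (Finset.mem_powerset.1 hT hv)
  have hdv : ∀ {v : V}, v ∈ D → ∀ {T : Finset V}, T ∈ L.powerset → v ∉ T := by
    intro v hv T hT h
    have h1 := hvL hT v h
    have h2 := ((hD v).1 hv).2
    omega
  rw [← Function.Bijective.sum_comp (compl_bijective (α := Finset V)),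
    ← Finset.sum_subset (Finset.subset_univ
      (L.powerset ∪ (D ×ˢ L.powerset).image fun p => insert p.1 p.2)), Finset.sum_union,
    Finset.sum_image, Finset.sum_product, Nat.cast_smul_eq_nsmul ℚ, ← Finset.sum_const]
  · congr 1
    · refine Finset.sum_congr rfl fun T hT => ?_
      rw [hC.signedCount_compl_of_leaves hconn hE (hvL hT), Finset.card_compl]
    · refine Finset.sum_congr rfl fun v hv => Finset.sum_congr rfl fun T hT => ?_
      rw [hC.signedCount_compl_of_insert hconn hE (hvL hT) ((hD v).1 hv).1 ((hD v).1 hv).2,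
        Finset.card_compl, Finset.card_insert_of_notMem (hdv hv hT),
        Nat.sub_sub _ T.card 1]
  -- The pair can be recovered from `insert v T`, since `v` is its only element of degree 2.
  · rintro ⟨v, T⟩ hp ⟨v', T'⟩ hp' h
    simp only [Finset.coe_product, Set.mem_prod, Finset.mem_coe] at hp hp'
    simp only at h
    have hv : v = v' := by
      have : v ∈ insert v' T' := h ▸ Finset.mem_insert_self v T
      exact (Finset.mem_insert.1 this).resolve_right (hdv hp.1 hp'.2)
    subst hv
    have hT : T = T' := by
      rw [← Finset.erase_insert (hdv hp.1 hp.2), h, Finset.erase_insert (hdv hp.1 hp'.2)]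
    rw [hT]
  · rw [Finset.disjoint_left]
    intro U hU hU'
    obtain ⟨⟨v, T⟩, hp, rfl⟩ := Finset.mem_image.1 hU'
    exact hdv (Finset.mem_product.1 hp).1 hU (Finset.mem_insert_self v T)
  · intro U _ hU
    rw [smul_eq_zero]
    left
    by_contra hne
    apply hU
    rw [Finset.mem_union]
    rcases hC.of_signedCount_compl_ne_zero hconn hE hne with h | ⟨v, hvU, hv, hd, h⟩
    · left
      exact Finset.mem_powerset.2 fun u hu => (hL u).2 (h u hu)
    · right
      refine Finset.mem_image.2 ⟨(v, U.erase v), Finset.mem_product.2 ⟨(hD v).2 ⟨hv, hd⟩,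
        Finset.mem_powerset.2 fun u hu => (hL u).2 (h u hu)⟩, Finset.insert_erase hvU⟩

open Polynomial in
theorem IsUniqueCycle.hookPoly_eq (hconn : G.Connected) (hC : IsUniqueCycle C)
    (hE : (E : Set (Sym2 V)) = G.edgeSet) {L D : Finset V}
    (hL : ∀ v, v ∈ L ↔ G.degree v = 1) (hD : ∀ v, v ∈ D ↔ v ∈ C.verts ∧ G.degree v = 2)
    {m : ℕ} (hm : Fintype.card V = L.card + m + 2) :
    hookPoly E =
      ((C.verts.ncard : ℚ) - 1) •
        ((-(1 + X)) ^ (m + 1) * (-X) ^ L.card - (-1) ^ (m + 1) * 0 ^ L.card) +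
      (D.card : ℚ) • ((-(1 + X)) ^ m * (-X) ^ L.card - (-1) ^ m * 0 ^ L.card) := by
  rw [hookPoly_eq_sum, hC.sum_signedCount hconn hE hL hD
    (fun b => (1 + X : ℚ[X]) ^ (b - 1) - 1), ← sum_powerset_signed_pow L (m + 1),
    ← sum_powerset_signed_pow L m]
  congr 1
  · rw [Finset.smul_sum]
    refine Finset.sum_congr rfl fun T hT => ?_
    have := Finset.card_le_card (Finset.mem_powerset.1 hT)
    rw [smul_smul, show Fintype.card V - T.card = m + 1 + (L.card - T.card) + 1 by omega,
      Nat.add_sub_cancel, pow_succ]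
    congr 1
    ring
  · congr 1
    refine Finset.sum_congr rfl fun T hT => ?_
    have := Finset.card_le_card (Finset.mem_powerset.1 hT)
    rw [show Fintype.card V - T.card - 2 = m + (L.card - T.card) by omega,
      show Fintype.card V - T.card - 1 - 1 = m + (L.card - T.card) by omega]

/-- Internal edges are those avoiding all leaves; each leaf removes exactly one of the $n$ edges,
and no edge is removed twice. -/
theorem IsUniqueCycle.ncard_internalEdges_add (hconn : G.Connected) (hC : IsUniqueCycle C)
    {L : Finset V} (hL : ∀ v, v ∈ L ↔ G.degree v = 1) :
    G.internalEdges.ncard + L.card = Fintype.card V := by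
  have hE : (G.edgeFinset : Set (Sym2 V)) = G.edgeSet := coe_edgeFinset G
  have h := card_edgesWithin_add hE (B := Lᶜ) (U := L) (by simp) (by
    intro x y hx hy
    rw [Finset.mem_compl, not_not, hL] at hx hy
    exact hC.not_adj_of_degree_one hconn hx hy)
  rw [hC.card_edges hconn hE, Finset.sum_congr rfl (fun v hv => (hL v).1 hv)] at h
  have h2 : G.internalEdges = (edgesWithin G.edgeFinset Lᶜ : Finset (Sym2 V)) := by
    ext e
    induction e with | h x y =>
    have h1 : ∀ v, v ∈ Lᶜ ↔ 2 ≤ G.degree v := by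
      intro v
      have := hC.one_le_degree hconn v
      rw [Finset.mem_compl, hL]
      omega
    rw [Finset.mem_coe, mk_mem_edgesWithin, mem_edgeFinset, h1, h1]
    simp [internalEdges]
  rw [h2, Set.ncard_coe_finset]
  simpa using h

end SimpleGraph

/-! ### Lowest-order terms and the main theorem. -/

open Polynomial in
theorem Polynomial.coeff_neg_X_pow_mul (l : ℕ) (P : ℚ[X]) :
    (∀ M < l, ((-X) ^ l * P).coeff M = 0) ∧ ((-X) ^ l * P).coeff l = (-1) ^ l * P.eval 0 := by
  have h : (-X : ℚ[X]) ^ l * P = C ((-1) ^ l) * (X ^ l * P) := by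
    rw [neg_pow]
    simp only [map_pow, map_neg, map_one]
    ring
  constructor
  · intro M hM
    rw [h, coeff_C_mul, coeff_X_pow_mul', if_neg (by omega), mul_zero]
  · rw [h, coeff_C_mul, coeff_X_pow_mul', if_pos le_rfl, Nat.sub_self, coeff_zero_eq_eval_zero]

/-- The hook with first part $M+1$ has $n-M$ parts, so the longest one corresponds to the least
degree $M\ge1$ in `hookPoly`. The constant coefficient plays no role, as the coefficient of $(1^n)$
vanishes separately. -/
theorem isLongestHook_of_hookPoly {V : Type*} [Fintype V] {G : SimpleGraph V}
    {E : Finset (Sym2 V)} (hE : (E : Set (Sym2 V)) = G.edgeSet) (hne : E.Nonempty) {n : ℕ}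
    {a : n.Partition → ℚ} (ha : G.IsStarExpansion a) {M : ℕ} (hM : 1 ≤ M) (hMn : M < n)
    (hlt : ∀ M' < M, 1 ≤ M' → (hookPoly E).coeff M' = 0) (h : (hookPoly E).coeff M ≠ 0) :
    (∃ lam : n.Partition, SimpleGraph.IsLongestHook a lam) ∧
    ∀ lam : n.Partition, SimpleGraph.IsLongestHook a lam →
      lam.parts.count 1 = n - 1 - M ∧ a lam = (-1) ^ M * (hookPoly E).coeff M := by
  obtain ⟨h0, h1⟩ := isStarExpansion_hook G E hE hne (by omega) a ha
  have hval := h1 M hMn hM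
  have key := isLongestHook_iff a hMn (by
    rw [hval]
    exact mul_ne_zero (pow_ne_zero _ (by norm_num)) h) (by
    intro M' hM'n hM'
    rcases Nat.eq_zero_or_pos M' with rfl | hpos
    · exact h0
    · rw [h1 M' hM'n hpos, hlt M' hM' hpos, mul_zero])
  refine ⟨⟨_, (key _).2 rfl⟩, ?_⟩
  intro lam hlam
  rw [(key lam).1 hlam]
  exact ⟨count_one_hookPartition hMn hM, hval⟩

theorem mainTheorem12 {V : Type*} [Fintype V] (G : SimpleGraph V) [DecidableRel G.Adj]
    (hconn : G.Connected) (C : G.Subgraph) (hC : SimpleGraph.IsUniqueCycle C)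
    (n k r c : ℕ) (hn : Fintype.card V = n)
    (hk : G.internalEdges.ncard = k)
    (hr : SimpleGraph.numNontrivialRootedTrees C = r)
    (hc : C.verts.ncard = c) :
    (∃! a : n.Partition → ℚ, G.IsStarExpansion a) ∧
    ∀ a : n.Partition → ℚ, G.IsStarExpansion a →
      (∃ lam : n.Partition, SimpleGraph.IsLongestHook a lam) ∧
      ∀ (lam : n.Partition) (m₁ : ℕ), SimpleGraph.IsLongestHook a lam →
        lam.parts.count 1 = m₁ →
          (r ≤ 1 → k = m₁ + 2) ∧
          (2 ≤ r → k = m₁ + 1) ∧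
          (r = 0 → a lam = (-1) ^ (k - 2)) ∧
          (r = 1 → a lam = (-1) ^ (k - 2) * ((c : ℚ) - 1)) ∧
          (2 ≤ r → a lam = (-1) ^ (k - 1) * ((r : ℚ) - 1)) := by
  classical
  refine ⟨existsUnique_isStarExpansion G hn, fun a ha => ?_⟩
  have hE : (G.edgeFinset : Set (Sym2 V)) = G.edgeSet := SimpleGraph.coe_edgeFinset G
  let L : Finset V := Finset.univ.filter fun v => G.degree v = 1
  have hL : ∀ v, v ∈ L ↔ G.degree v = 1 := by simp [L]
  let D : Finset V := Finset.univ.filter fun v => v ∈ C.verts ∧ G.degree v = 2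
  have hD : ∀ v, v ∈ D ↔ v ∈ C.verts ∧ G.degree v = 2 := by simp [D]
  have hc3 := hC.1.three_le_ncard_edgeSet
  rw [hC.1.ncard_edgeSet, hc] at hc3
  have hLc := hC.card_leaves_add_le hL
  have hkL := hC.ncard_internalEdges_add hconn hL
  have hDr := hC.card_degree_two_add hD
  have hr0 := hC.leaves_eq_empty_iff hconn hL
  rw [hc, hn] at hLc
  rw [hk, hn] at hkL
  rw [hr, hc] at hDr
  rw [hr] at hr0
  have hne : G.edgeFinset.Nonempty := by
    rw [← Finset.card_pos, hC.card_edges hconn hE]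
    omega
  obtain ⟨m, rfl⟩ : ∃ m, k = m + 2 := ⟨k - 2, by omega⟩
  have hF := hC.hookPoly_eq hconn hE hL hD (m := m) (by omega)
  rw [hc] at hF
  have hDc : (D.card : ℚ) = c - r := by
    rw [eq_sub_iff_add_eq]
    exact_mod_cast hDr
  rw [hDc] at hF
  have hc3' : (3 : ℚ) ≤ c := by exact_mod_cast hc3
  rcases Nat.eq_zero_or_pos L.card with hl | hl
  · have hr' : r = 0 := hr0.2 (Finset.card_eq_zero.1 hl)
    subst hr'
    have hlen : D.card = C.verts.ncard := by omega
    -- Without leaves $G$ is the cycle itself, so $c=n=m+2$.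
    have hcn : c = m + 2 := by
      have h2 : C.verts = Set.univ := by
        apply hC.verts_eq_univ hconn
        intro v hv
        have h3 : (D : Set V) = C.verts := by
          refine Set.eq_of_subset_of_ncard_le (fun v hv => ((hD v).1 hv).1) ?_ (Set.toFinite _)
          rw [Set.ncard_coe_finset, hlen]
        rw [← h3] at hv
        exact ((hD v).1 hv).2
      rw [← hc, h2, Set.ncard_univ, Nat.card_eq_fintype_card]
      omega
    have hcoeff : ∀ N : ℕ, ((-(1 + Polynomial.X) : Polynomial ℚ) ^ N * (-Polynomial.X) ^ L.card -
        (-1) ^ N * 0 ^ L.card).coeff 1 = (-1 : ℚ) ^ N * (N : ℚ) := by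
      intro N
      have h1 : ((-1 : Polynomial ℚ) ^ N) = Polynomial.C ((-1) ^ N) := by simp
      rw [hl, pow_zero, pow_zero, mul_one, mul_one, neg_pow, h1, Polynomial.coeff_sub,
        Polynomial.coeff_C_mul, Polynomial.coeff_one_add_X_pow, Polynomial.coeff_C]
      simp
    -- With $c=m+2$ the coefficient is $(-1)^{m+1}\bigl((m+1)^2-m(m+2)\bigr)=(-1)^{m+1}$.
    have h1 : (hookPoly G.edgeFinset).coeff 1 = (-1) ^ (m + 1) := by
      rw [hF, Polynomial.coeff_add, Polynomial.coeff_smul, Polynomial.coeff_smul, hcoeff, hcoeff,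
        hcn, pow_succ]
      simp only [smul_eq_mul]
      push_cast
      ring
    obtain ⟨h2, h3⟩ := isLongestHook_of_hookPoly hE hne ha (M := 1) le_rfl (by omega)
      (fun M' h h' => by omega) (by rw [h1]; exact pow_ne_zero _ (by norm_num))
    refine ⟨h2, fun lam m₁ hlam hm₁ => ?_⟩
    obtain ⟨h4, h5⟩ := h3 lam hlam
    refine ⟨fun _ => by omega, fun h => by omega, fun _ => ?_, fun h => by omega,
      fun h => by omega⟩
    rw [h5, h1, Nat.add_sub_cancel, pow_succ]
    ring
  · have hrpos : 1 ≤ r := by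
      rcases Nat.eq_zero_or_pos r with h | h
      · rw [hr0.1 h] at hl
        simp at hl
      · exact h
    rw [zero_pow hl.ne', mul_zero, mul_zero, sub_zero, sub_zero] at hF
    rcases Nat.eq_or_lt_of_le hrpos with hr1 | hr2
    -- For $r=1$ both summands carry the factor $c-1$, and $-(1+X)+1=-X$ raises the order of
    -- vanishing to $l+1$.
    · have hF' : hookPoly G.edgeFinset = (-Polynomial.X) ^ (L.card + 1) *
          (Polynomial.C ((c : ℚ) - 1) * (-(1 + Polynomial.X)) ^ m) := by
        rw [hF, ← hr1, Polynomial.smul_eq_C_mul, Polynomial.smul_eq_C_mul]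
        push_cast
        ring
      obtain ⟨hz, hv⟩ := Polynomial.coeff_neg_X_pow_mul (L.card + 1)
        (Polynomial.C ((c : ℚ) - 1) * (-(1 + Polynomial.X)) ^ m)
      rw [← hF'] at hz hv
      have hv' : (hookPoly G.edgeFinset).coeff (L.card + 1) =
          (-1) ^ (L.card + 1) * (((c : ℚ) - 1) * (-1) ^ m) := by
        rw [hv]; simp
      have hc1 : (c : ℚ) - 1 ≠ 0 := by linarith
      obtain ⟨h2, h3⟩ := isLongestHook_of_hookPoly hE hne ha (M := L.card + 1) (by omega)
        (by omega) (fun M' h _ => hz M' h) (by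
          rw [hv']
          exact mul_ne_zero (pow_ne_zero _ (by norm_num))
            (mul_ne_zero hc1 (pow_ne_zero _ (by norm_num))))
      refine ⟨h2, fun lam m₁ hlam hm₁ => ?_⟩
      obtain ⟨h4, h5⟩ := h3 lam hlam
      refine ⟨fun _ => by omega, fun h => by omega, fun h => by omega, fun _ => ?_,
        fun h => by omega⟩
      rw [h5, hv', Nat.add_sub_cancel, ← mul_assoc, ← mul_pow]
      simp [mul_comm]
    -- For $r\ge2$ the second factor at $X=0$ is $-(c-1)+(c-r)=1-r\ne0$, so the order of vanishing
    -- stays $l$.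
    · have hF' : hookPoly G.edgeFinset = (-Polynomial.X) ^ L.card *
          ((-(1 + Polynomial.X)) ^ m * (Polynomial.C ((c : ℚ) - 1) * (-(1 + Polynomial.X)) +
            Polynomial.C ((c : ℚ) - r))) := by
        rw [hF, Polynomial.smul_eq_C_mul, Polynomial.smul_eq_C_mul]
        ring
      obtain ⟨hz, hv⟩ := Polynomial.coeff_neg_X_pow_mul L.card
        ((-(1 + Polynomial.X)) ^ m * (Polynomial.C ((c : ℚ) - 1) * (-(1 + Polynomial.X)) +
            Polynomial.C ((c : ℚ) - r)))
      rw [← hF'] at hz hv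
      have hv' : (hookPoly G.edgeFinset).coeff L.card =
          (-1) ^ L.card * ((-1) ^ m * (1 - (r : ℚ))) := by
        rw [hv]
        simp
      have hr2' : (2 : ℚ) ≤ r := by exact_mod_cast hr2
      have hc1 : 1 - (r : ℚ) ≠ 0 := by linarith
      obtain ⟨h2, h3⟩ := isLongestHook_of_hookPoly hE hne ha (M := L.card) (by omega)
        (by omega) (fun M' h _ => hz M' h) (by
          rw [hv']
          exact mul_ne_zero (pow_ne_zero _ (by norm_num))
            (mul_ne_zero (pow_ne_zero _ (by norm_num)) hc1))
      refine ⟨h2, fun lam m₁ hlam hm₁ => ?_⟩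
      obtain ⟨h4, h5⟩ := h3 lam hlam
      refine ⟨fun h => by omega, fun _ => by omega, fun h => by omega, fun h => by omega,
        fun _ => ?_⟩
      rw [h5, hv', ← mul_assoc, ← mul_pow, show m + 2 - 1 = m + 1 by omega, pow_succ]
      simp only [mul_neg, mul_one, neg_neg, one_pow, one_mul]
      ring
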